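/- **Theorem (Second correspondence theorem).** Let $(\mathcal C,\mathbb E,\mathfrak s)$ be an extriangulated category (in the sense of Nakaoka and Palu) with higher extension groups, that is, one of the following holds: $\mathcal C$ is abelian with the short exact sequences as conflations, and $\mathbb E^i=\mathrm{Ext}^i_{\mathcal C}$ (Yoneda); or $\mathcal C$ is triangulated with its standard extriangulated structure, and $\mathbb E^i(X,Y)=\mathrm{Hom}_{\mathcal C}(X,Y[i])$; or $\mathcal C$ has enough $\mathbb E$-projectives and enough $\mathbb E$-injectives, and $\mathbb E^{k+1}(X,Y)=\mathbb E(X,\Sigma^kY)$ for $k\ge 0$, where $\Sigma^k Y$ is a $k$-th cosyzygy of $Y$. All subcategories are full and are identified with classes of objects. *Terminology.* For a class $\mathcal X$ of objects: - $\mathcal X^\wedge$ is the class of objects $M$ having a finite $\mathcal X$-resolution, i.e. there are $n\ge 0$ and conflations $K_{i+1}\to X_i\to K_i$ for $0\le i<n$ with $K_0=M$, all $X_i\in\mathcal X$, and $K_n$ isomorphic to an object of $\mathcal X$. - $\mathcal X$ is *left* (resp. *right*) *thick* if it is closed under extensions, direct summands and cocones (resp. cones) of conflations, and *thick* if it is both;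 $\mathsf{Thick}(\mathcal X)$ is the smallest thick class containing $\mathcal X$. - $\mathrm{id}_{\mathcal X}(\mathcal Y)=0$ means that $\mathbb E^i(X,Y)=0$ for all $i\ge 1$, $X\in\mathcal X$, $Y\in\mathcal Y$, and $\mathrm{pd}_{\mathcal X}(\mathcal Y)=0$ means that $\mathbb E^i(Y,X)=0$ for all such $i,X,Y$. - $\omega\subseteq\mathcal X$ is a *relative cogenerator* (resp. *generator*) in $\mathcal X$ if each $X\in\mathcal X$ has a conflation $X\to W\to X'$ (resp. $X'\to W\to X$) with $W\in\omega$, $X'\in\mathcal X$. - $(\mathcal X,\omega)$ is a *left Frobenius pair* if $\mathcal X$ is left thick, $\omega$ is closed under direct summands and is a relative cogenerator in $\mathcal X$, and $\mathrm{id}_{\mathcal X}(\omega)=0$. Let $\mathcal S$ be a class of objects. - $(\mathcal X,\omega)$ is a *left Frobenius pair cut on $\mathcal S$* if $\mathcal X$ is left thick, $(\mathcal X\cap\mathcal S,\omega\cap\mathcal S)$ is a left Frobenius pair, $\omega\cap\mathcal S$ is a relative generator in $\omega$ with $\mathrm{pd}_\omega(\omega\cap\mathcal S)=0$, and $\omega$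 is closed under extensions and direct summands. - $(\mathcal A,\mathcal B)$ is a *left weak AB-context cut on $\mathcal S$* if $(\mathcal A,\mathcal A\cap\mathcal B)$ is a left Frobenius pair cut on $\mathcal S$, $\mathcal B\cap\mathcal S$ is right thick, and $\mathcal B\cap\mathcal S\subseteq(\mathcal A\cap\mathcal S)^\wedge$. Let $\mathfrak C_{\mathcal S}$ be the collection of these pairs. - $(\mathcal A,\mathcal B)$ is a *$1$-cotorsion pair cut on $\mathcal S$* if $\mathcal A$ and $\mathcal B$ are closed under direct summands, $\mathbb E^1(\mathcal A\cap\mathcal S,\mathcal B)=0=\mathbb E^1(\mathcal A,\mathcal B\cap\mathcal S)$, and each $S\in\mathcal S$ has conflations $K\to A\to S$ and $S\to B\to L$ with $A,L\in\mathcal A$ and $B,K\in\mathcal B$. - $\mathfrak P_{\mathcal S}$ is the collection of pairs $(\mathcal F,\mathcal G)$ that are $1$-cotorsion pairs cut on $\mathsf{Thick}(\mathcal F)$, with $\mathrm{id}_{\mathcal F}(\mathcal G)=0$ and with $\mathcal F\cap\mathcal G\cap\mathcal S$ both a relative generator and a relative cogenerator in $\mathcal F\cap\mathcal G$. On each of $\mathfrak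 P_{\mathcal S}$ and $\mathfrak C_{\mathcal S}$ let $(\mathcal A,\mathcal B)\sim(\mathcal A',\mathcal B')$ mean that $\mathcal A\cap\mathcal S=\mathcal A'\cap\mathcal S$ and $\mathcal A\cap\mathcal B\cap\mathcal S=\mathcal A'\cap\mathcal B'\cap\mathcal S$, and write $[\mathcal A,\mathcal B]$ for the equivalence class. *Claim.* If $\mathcal S$ is a thick subcategory of $\mathcal C$, then $$\Lambda_{\mathcal S}:\mathfrak P_{\mathcal S}/\!\sim\ \to\ \mathfrak C_{\mathcal S}/\!\sim,\qquad [\mathcal F,\mathcal G]\mapsto[\mathcal F,(\mathcal F\cap\mathcal G)^\wedge]$$ is a well-defined bijection, with (well-defined) inverse $[\mathcal A,\mathcal B]\mapsto[\mathcal A\cap\mathcal S,\mathcal B\cap\mathcal S]$. -/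

import Mathlib

open CategoryTheory CategoryTheory.Limits Opposite

universe w v u

/-! ## Extriangulated categories -/

namespace Extri

section Basic

variable {C : Type u} [Category.{v} C]

/-- `𝔼(Z, A)` for a bifunctor `𝔼 : Cᵒᵖ × C ⥤ Ab` (written in curried form). -/
abbrev Extn (E : Cᵒᵖ ⥤ C ⥤ AddCommGrpCat.{w}) (Z A : C) : Type w :=
  ((E.obj (op Z)).obj A : AddCommGrpCat.{w})

/-- `a δ := 𝔼(Z, a)(δ)`. -/
def push (E : Cᵒᵖ ⥤ C ⥤ AddCommGrpCat.{w}) {Z A A' : C} (a : A ⟶ A') (δ : Extn E Z A) :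
    Extn E Z A' :=
  ((E.obj (op Z)).map a).hom δ

/-- `δ c := 𝔼(c, A)(δ)`. -/
def pull (E : Cᵒᵖ ⥤ C ⥤ AddCommGrpCat.{w}) {Z Z' A : C} (c : Z' ⟶ Z) (δ : Extn E Z A) :
    Extn E Z' A :=
  ((E.map c.op).app A).hom δ

/-- The element of `𝔼(Z ⊕ Z', A ⊕ A')` with components `(δ, 0, 0, δ')`. -/
noncomputable def extnSum [Preadditive C] [HasBinaryBiproducts C]
    (E : Cᵒᵖ ⥤ C ⥤ AddCommGrpCat.{w}) {Z Z' A A' : C}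
    (δ : Extn E Z A) (δ' : Extn E Z' A') : Extn E (Z ⊞ Z') (A ⊞ A') :=
  pull E biprod.fst (push E biprod.inl δ) + pull E biprod.snd (push E biprod.inr δ')

/-- A sequence `A ⟶ B ⟶ Z` with prescribed ends. -/
structure Seq (A Z : C) where
  mid : C
  i : A ⟶ mid
  p : mid ⟶ Z

/-- Equivalence of sequences: an isomorphism of the middle terms compatible with the maps. -/
instance seqSetoid (A Z : C) : Setoid (Seq A Z) where
  r s t := ∃ b : s.mid ≅ t.mid, s.i ≫ b.hom = t.i ∧ b.hom ≫ t.p = s.p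
  iseqv :=
    { refl := fun s => ⟨Iso.refl _, by simp, by simp⟩
      symm := by
        rintro s t ⟨b, h₁, h₂⟩
        exact ⟨b.symm, by simp [← h₁], by simp [← h₂]⟩
      trans := by
        rintro s t r ⟨b, h₁, h₂⟩ ⟨b', h₁', h₂'⟩
        exact ⟨b.trans b', by simp [← h₁', ← h₁], by simp [h₂', h₂]⟩ }

/-- The equivalence class `[A ⟶ B ⟶ Z]`. -/
def seqClass {A B Z : C} (x : A ⟶ B) (y : B ⟶ Z) : Quotient (seqSetoid A Z) :=
  Quotient.mk (seqSetoid A Z) ⟨B, x, y⟩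

end Basic

/-- An external triangulation `(𝔼, 𝔰)` of an additive category `C`. -/
class ExtriangulatedCategory (C : Type u) [Category.{v} C] [Preadditive C]
    [HasZeroObject C] [HasBinaryBiproducts C] where
  /-- The bifunctor `𝔼`. -/
  E : Cᵒᵖ ⥤ C ⥤ AddCommGrpCat.{w}
  additive_left : E.Additive
  additive_right : ∀ Z : Cᵒᵖ, (E.obj Z).Additive
  /-- The correspondence `𝔰`. -/
  s : ∀ {A Z : C}, Extn E Z A → Quotient (seqSetoid A Z)
  realize_hom : ∀ {A B Z A' B' Z' : C} (δ : Extn E Z A) (δ' : Extn E Z' A')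
    (x : A ⟶ B) (y : B ⟶ Z) (x' : A' ⟶ B') (y' : B' ⟶ Z'),
    s δ = seqClass x y → s δ' = seqClass x' y' →
    ∀ (a : A ⟶ A') (c : Z ⟶ Z'), push E a δ = pull E c δ' →
      ∃ b : B ⟶ B', x ≫ b = a ≫ x' ∧ y ≫ c = b ≫ y'
  s_zero : ∀ A Z : C,
    s (0 : Extn E Z A) = seqClass (biprod.inl : A ⟶ A ⊞ Z) (biprod.snd : A ⊞ Z ⟶ Z)
  s_sum : ∀ {A B Z A' B' Z' : C} (δ : Extn E Z A) (δ' : Extn E Z' A')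
    (x : A ⟶ B) (y : B ⟶ Z) (x' : A' ⟶ B') (y' : B' ⟶ Z'),
    s δ = seqClass x y → s δ' = seqClass x' y' →
    s (extnSum E δ δ') = seqClass (biprod.map x x') (biprod.map y y')
  et3 : ∀ {A B Z A' B' Z' : C} (δ : Extn E Z A) (δ' : Extn E Z' A')
    (x : A ⟶ B) (y : B ⟶ Z) (x' : A' ⟶ B') (y' : B' ⟶ Z'),
    s δ = seqClass x y → s δ' = seqClass x' y' →
    ∀ (a : A ⟶ A') (b : B ⟶ B'), x ≫ b = a ≫ x' →
      ∃ c : Z ⟶ Z', push E a δ = pull E c δ' ∧ y ≫ c = b ≫ y'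
  et3_op : ∀ {A B Z A' B' Z' : C} (δ : Extn E Z A) (δ' : Extn E Z' A')
    (x : A ⟶ B) (y : B ⟶ Z) (x' : A' ⟶ B') (y' : B' ⟶ Z'),
    s δ = seqClass x y → s δ' = seqClass x' y' →
    ∀ (b : B ⟶ B') (c : Z ⟶ Z'), y ≫ c = b ≫ y' →
      ∃ a : A ⟶ A', push E a δ = pull E c δ' ∧ x ≫ b = a ≫ x'
  et4 : ∀ {A B D M F : C} (δ : Extn E D A) (δ' : Extn E F B)
    (f : A ⟶ B) (f' : B ⟶ D) (g : B ⟶ M) (g' : M ⟶ F),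
    s δ = seqClass f f' → s δ' = seqClass g g' →
    ∃ (K : C) (d : D ⟶ K) (e : K ⟶ F) (h : A ⟶ M) (h' : M ⟶ K) (δ'' : Extn E K A),
      f ≫ g = h ∧ f' ≫ d = g ≫ h' ∧ h' ≫ e = g' ∧
      s δ'' = seqClass h h' ∧ s (push E f' δ') = seqClass d e ∧
      pull E d δ'' = δ ∧ push E f δ'' = pull E e δ'
  et4_op : ∀ {D A B F M : C} (δ : Extn E B D) (δ' : Extn E M F)
    (f' : D ⟶ A) (f : A ⟶ B) (g' : F ⟶ B) (g : B ⟶ M),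
    s δ = seqClass f' f → s δ' = seqClass g' g →
    ∃ (K : C) (d : D ⟶ K) (e : K ⟶ F) (h' : K ⟶ A) (h : A ⟶ M) (δ'' : Extn E M K),
      d ≫ h' = f' ∧ h' ≫ f = e ≫ g' ∧ f ≫ g = h ∧
      s δ'' = seqClass h' h ∧ s (pull E g' δ) = seqClass d e ∧
      δ' = push E e δ'' ∧ push E d δ = pull E g δ''

section

variable (C : Type u) [Category.{v} C] [Preadditive C] [HasZeroObject C] [HasBinaryBiproducts C]
  [ExtriangulatedCategory.{w} C]

/-- The group `𝔼(Z, A)` of the given extriangulated structure. -/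
abbrev EE {C : Type u} [Category.{v} C] [Preadditive C] [HasZeroObject C] [HasBinaryBiproducts C]
    [ExtriangulatedCategory.{w} C] (Z A : C) : Type w :=
  Extn (ExtriangulatedCategory.E (C := C)) Z A

variable {C}

/-- `A ⟶ B ⟶ Z` realizes `δ`, i.e. `A ⟶ B ⟶ Z ⇢ δ` is an `𝔼`-triangle. -/
def Realizes {A B Z : C} (δ : EE Z A) (x : A ⟶ B) (y : B ⟶ Z) : Prop :=
  ExtriangulatedCategory.s δ = seqClass x y

/-- A sequence that realizes some extension. -/
def Conflation {A B Z : C} (x : A ⟶ B) (y : B ⟶ Z) : Prop :=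
  ∃ δ : EE Z A, Realizes δ x y

/-- Existence of a conflation `A ⟶ B ⟶ Z`, equivalently of an `𝔼`-triangle `A ⟶ B ⟶ Z ⇢`. -/
def HasConflation (A B Z : C) : Prop :=
  ∃ (x : A ⟶ B) (y : B ⟶ Z), Conflation x y

def EProjective (P : C) : Prop :=
  ∀ ⦃A B Z : C⦄ (x : A ⟶ B) (y : B ⟶ Z), Conflation x y →
    ∀ g : P ⟶ Z, ∃ f : P ⟶ B, f ≫ y = g

def EInjective (I : C) : Prop :=
  ∀ ⦃A B Z : C⦄ (x : A ⟶ B) (y : B ⟶ Z), Conflation x y →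
    ∀ g : A ⟶ I, ∃ f : B ⟶ I, x ≫ f = g

variable (C) in
def EnoughEProjectives : Prop :=
  ∀ Z : C, ∃ A P : C, EProjective P ∧ HasConflation A P Z

variable (C) in
def EnoughEInjectives : Prop :=
  ∀ A : C, ∃ I Z : C, EInjective I ∧ HasConflation A I Z

/-! ## Higher extension groups -/

/-- The additive category `C` is abelian (for its given preadditive structure). -/
structure IsAbelianCat (C : Type u) [Category.{v} C] [Preadditive C] : Prop where
  hasKernels : HasKernels C
  hasCokernels : HasCokernels C
  normalMono : IsNormalMonoCategory C
  normalEpi : IsNormalEpiCategory C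

/-- Mathlib's abelian structure on `C`, over the given preadditive structure. -/
@[reducible] def IsAbelianCat.toAbelian {C : Type u} [Category.{v} C] [Preadditive C]
    [HasZeroObject C] [HasBinaryBiproducts C] (h : IsAbelianCat C) : Abelian C :=
  letI := h.hasKernels
  letI := h.hasCokernels
  letI := h.normalMono
  letI := h.normalEpi
  { has_kernels := h.hasKernels
    has_cokernels := h.hasCokernels
    has_finite_products := hasFiniteProducts_of_has_binary_and_terminal }

/-- Yoneda's group `Ext^n(X, Y)` in an abelian category. -/
noncomputable def abelianExt {C : Type u} [Category.{v} C] [Preadditive C]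
    [HasZeroObject C] [HasBinaryBiproducts C] (h : IsAbelianCat C) (n : ℕ) (X Y : C) :
    AddCommGrpCat.{max u v} :=
  letI := h.toAbelian
  letI : HasExt.{max u v} C := HasExt.standard C
  AddCommGrpCat.of (Abelian.Ext.{max u v} X Y n)

variable (C) in
/-- The three ways in which an extriangulated category has higher extension groups:
it is an abelian category, with the short exact sequences as its conflations; or it is a
triangulated category, with `𝔼(Z, A) = Hom(Z, A[1])` and with `δ` realized by `A ⟶ B ⟶ Z`
exactly when `A ⟶ B ⟶ Z ⟶ A[1]` (the last map being `δ`) is a distinguished triangle; or it has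
enough `𝔼`-projectives and enough `𝔼`-injectives. -/
inductive HigherExtensions : Type (max u v w)
  | abelian (hab : IsAbelianCat C)
      (conflation_iff : ∀ {A B Z : C} (x : A ⟶ B) (y : B ⟶ Z),
        Conflation x y ↔ ∃ zero : x ≫ y = 0, (ShortComplex.mk x y zero).ShortExact)
  | triangulated [sh : HasShift C ℤ] [ad : ∀ n : ℤ, (shiftFunctor C n).Additive]
      [pt : Pretriangulated C] [tr : IsTriangulated C]
      (φ : ∀ Z A : C, EE Z A ≃+ (Z ⟶ (shiftFunctor C (1 : ℤ)).obj A))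
      (φ_push : ∀ {Z A A' : C} (a : A ⟶ A') (δ : EE Z A),
        φ Z A' (push _ a δ) = φ Z A δ ≫ (shiftFunctor C (1 : ℤ)).map a)
      (φ_pull : ∀ {Z Z' A : C} (c : Z' ⟶ Z) (δ : EE Z A),
        φ Z' A (pull _ c δ) = c ≫ φ Z A δ)
      (realizes_iff : ∀ {A B Z : C} (δ : EE Z A) (x : A ⟶ B) (y : B ⟶ Z),
        Realizes δ x y ↔
          Pretriangulated.Triangle.mk x y (φ Z A δ) ∈ Pretriangulated.distinguishedTriangles)
  | enough (hproj : EnoughEProjectives C) (hinj : EnoughEInjectives C)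

/-- A chosen cosyzygy `ΣY`: the third term of an `𝔼`-triangle `Y ⟶ I ⟶ ΣY ⇢` with `I`
an `𝔼`-injective object. -/
noncomputable def cosyzygy (h : EnoughEInjectives C) (Y : C) : C :=
  (h Y).choose_spec.choose

/-- The iterated cosyzygy `Σ^k Y`. -/
noncomputable def cosyzygyIter (h : EnoughEInjectives C) : ℕ → C → C
  | 0, Y => Y
  | k + 1, Y => cosyzygy h (cosyzygyIter h k Y)

/-- The group `𝔼^n(X, Y)`: Yoneda's `Ext^n(X, Y)` for abelian categories, `Hom(X, Y[n])` for
triangulated categories, and `𝔼^(k+1)(X, Y) = 𝔼(X, Σ^k Y)` if there are enough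
`𝔼`-projectives and `𝔼`-injectives (where `𝔼^0(X, Y)`, which is never used, is `Hom(X, Y)`). -/
noncomputable def HigherExtensions.ext (H : HigherExtensions.{w} C) (n : ℕ) (X Y : C) :
    AddCommGrpCat.{max u v w} :=
  match H, n with
  | .abelian hab _, n => AddCommGrpCat.of (ULift.{w} (abelianExt hab n X Y))
  | .triangulated (sh := _) (ad := _) (pt := _) (tr := _) _ _ _ _, n =>
      AddCommGrpCat.of (ULift.{max u w} (X ⟶ (shiftFunctor C (n : ℤ)).obj Y))
  | .enough _ _, 0 => AddCommGrpCat.of (ULift.{max u w} (X ⟶ Y))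
  | .enough _ hinj, k + 1 => AddCommGrpCat.of (ULift.{max u v} (EE X (cosyzygyIter hinj k Y)))

/-- `𝔼^n(𝒳, 𝒴) = 0`. -/
def HigherExtensions.Vanish (H : HigherExtensions.{w} C) (n : ℕ) (𝒳 𝒴 : ObjectProperty C) :
    Prop :=
  ∀ X Y : C, 𝒳 X → 𝒴 Y → Subsingleton (H.ext n X Y)

/-- `id_𝒳(M)`, the least `m ≥ 0` such that `𝔼^j(𝒳, M) = 0` for all `j ≥ m + 1`. -/
noncomputable def injDimObj (H : HigherExtensions.{w} C) (𝒳 : ObjectProperty C) (M : C) : ℕ∞ :=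
  ⨅ (m : ℕ) (_ : ∀ j, m + 1 ≤ j → ∀ X, 𝒳 X → Subsingleton (H.ext j X M)), (m : ℕ∞)

/-- `id_𝒳(𝒴)`. -/
noncomputable def injDim (H : HigherExtensions.{w} C) (𝒳 𝒴 : ObjectProperty C) : ℕ∞ :=
  ⨆ (Y : C) (_ : 𝒴 Y), injDimObj H 𝒳 Y

/-- `pd_𝒳(M)`, the least `m ≥ 0` such that `𝔼^j(M, 𝒳) = 0` for all `j ≥ m + 1`. -/
noncomputable def projDimObj (H : HigherExtensions.{w} C) (𝒳 : ObjectProperty C) (M : C) : ℕ∞ :=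
  ⨅ (m : ℕ) (_ : ∀ j, m + 1 ≤ j → ∀ X, 𝒳 X → Subsingleton (H.ext j M X)), (m : ℕ∞)

/-- `pd_𝒳(𝒴)`. -/
noncomputable def projDim (H : HigherExtensions.{w} C) (𝒳 𝒴 : ObjectProperty C) : ℕ∞ :=
  ⨆ (Y : C) (_ : 𝒴 Y), projDimObj H 𝒳 Y

theorem iInf_eq_zero_aux (p : ℕ → Prop) :
    (⨅ (m : ℕ) (_ : p m), (m : ℕ∞)) = 0 ↔ p 0 := by
  constructor
  · intro h
    by_contra h0
    have h1 : (1 : ℕ∞) ≤ ⨅ (m : ℕ) (_ : p m), (m : ℕ∞) := by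
      refine le_iInf fun m => le_iInf fun hm => ?_
      have : 1 ≤ m := by
        rcases Nat.eq_zero_or_pos m with rfl | hpos
        · exact absurd hm h0
        · exact hpos
      exact_mod_cast this
    rw [h] at h1
    exact absurd h1 (by simp)
  · intro h0
    exact le_antisymm (iInf_le_of_le 0 (iInf_le_of_le h0 (by simp))) bot_le

theorem injDim_eq_zero_iff (H : HigherExtensions.{w} C) (𝒳 𝒴 : ObjectProperty C) :
    injDim H 𝒳 𝒴 = 0 ↔ ∀ j, 1 ≤ j → H.Vanish j 𝒳 𝒴 := by
  have h : injDim H 𝒳 𝒴 = 0 ↔ ∀ Y, 𝒴 Y → injDimObj H 𝒳 Y = 0 := by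
    simp only [injDim, ENat.iSup_eq_zero]
  rw [h]
  simp only [injDimObj, iInf_eq_zero_aux, HigherExtensions.Vanish, zero_add]
  exact ⟨fun h j hj X Y hX hY => h Y hY j hj X hX, fun h Y hY j hj X hX => h j hj X Y hX hY⟩

theorem projDim_eq_zero_iff (H : HigherExtensions.{w} C) (𝒳 𝒴 : ObjectProperty C) :
    projDim H 𝒳 𝒴 = 0 ↔ ∀ j, 1 ≤ j → H.Vanish j 𝒴 𝒳 := by
  have h : projDim H 𝒳 𝒴 = 0 ↔ ∀ Y, 𝒴 Y → projDimObj H 𝒳 Y = 0 := by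
    simp only [projDim, ENat.iSup_eq_zero]
  rw [h]
  simp only [projDimObj, iInf_eq_zero_aux, HigherExtensions.Vanish, zero_add]
  exact ⟨fun h j hj X Y hX hY => h X hX j hj Y hY, fun h Y hY j hj X hX => h j hj Y X hY hX⟩

/-! ## Classes of objects -/

/-- Finite `𝒳`-resolutions of length `n`, i.e. conflations `K_{i+1} ⟶ X_i ⟶ K_i` for `i < n`
with `K_0 = M`, all `X_i` in `𝒳`, and `K_n` isomorphic to an object of `𝒳`. -/
def HasResolution (𝒳 : ObjectProperty C) : ℕ → C → Prop
  | 0, M => ∃ X : C, 𝒳 X ∧ Nonempty (X ≅ M)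
  | n + 1, M => ∃ K X : C, 𝒳 X ∧ HasResolution 𝒳 n K ∧ HasConflation K X M

/-- Finite `𝒳`-coresolutions of length `n`. -/
def HasCoresolution (𝒳 : ObjectProperty C) : ℕ → C → Prop
  | 0, M => ∃ X : C, 𝒳 X ∧ Nonempty (X ≅ M)
  | n + 1, M => ∃ X K : C, 𝒳 X ∧ HasCoresolution 𝒳 n K ∧ HasConflation M X K

/-- `𝒳^∧_n`, the objects of `𝒳`-resolution dimension at most `n`. -/
def resLE (𝒳 : ObjectProperty C) (n : ℕ) : ObjectProperty C :=
  fun M => ∃ m, m ≤ n ∧ HasResolution 𝒳 m M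

/-- `𝒳^∨_n`, the objects of `𝒳`-coresolution dimension at most `n`. -/
def coresLE (𝒳 : ObjectProperty C) (n : ℕ) : ObjectProperty C :=
  fun M => ∃ m, m ≤ n ∧ HasCoresolution 𝒳 m M

/-- `𝒳^∧`, the objects of finite `𝒳`-resolution dimension. -/
def wedge (𝒳 : ObjectProperty C) : ObjectProperty C :=
  fun M => ∃ n, resLE 𝒳 n M

def ClosedUnderExtensions (𝒳 : ObjectProperty C) : Prop :=
  ∀ A B Z : C, HasConflation A B Z → 𝒳 A → 𝒳 Z → 𝒳 B

def ClosedUnderCones (𝒳 : ObjectProperty C) : Prop :=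
  ∀ A B Z : C, HasConflation A B Z → 𝒳 A → 𝒳 B → 𝒳 Z

def ClosedUnderCocones (𝒳 : ObjectProperty C) : Prop :=
  ∀ A B Z : C, HasConflation A B Z → 𝒳 B → 𝒳 Z → 𝒳 A

def ClosedUnderSummands (𝒳 : ObjectProperty C) : Prop :=
  ∀ M A B : C, Nonempty (M ≅ A ⊞ B) → 𝒳 M → 𝒳 A

structure LeftThick (𝒳 : ObjectProperty C) : Prop where
  extensions : ClosedUnderExtensions 𝒳
  summands : ClosedUnderSummands 𝒳
  cocones : ClosedUnderCocones 𝒳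

structure RightThick (𝒳 : ObjectProperty C) : Prop where
  extensions : ClosedUnderExtensions 𝒳
  summands : ClosedUnderSummands 𝒳
  cones : ClosedUnderCones 𝒳

structure IsThick (𝒳 : ObjectProperty C) : Prop where
  left : LeftThick 𝒳
  right : RightThick 𝒳

/-- `Thick(𝒳)`, the intersection of all thick subcategories that contain `𝒳`. -/
def Thick (𝒳 : ObjectProperty C) : ObjectProperty C :=
  fun M => ∀ 𝒯 : ObjectProperty C, IsThick 𝒯 → 𝒳 ≤ 𝒯 → 𝒯 M

theorem le_thick (𝒳 : ObjectProperty C) : 𝒳 ≤ Thick 𝒳 :=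
  fun M hM _ _ h => h M hM

theorem isThick_thick (𝒳 : ObjectProperty C) : IsThick (Thick 𝒳) where
  left :=
    { extensions := fun A B Z h hA hZ 𝒯 h𝒯 hle =>
        h𝒯.left.extensions A B Z h (hA 𝒯 h𝒯 hle) (hZ 𝒯 h𝒯 hle)
      summands := fun M A B h hM 𝒯 h𝒯 hle => h𝒯.left.summands M A B h (hM 𝒯 h𝒯 hle)
      cocones := fun A B Z h hB hZ 𝒯 h𝒯 hle =>
        h𝒯.left.cocones A B Z h (hB 𝒯 h𝒯 hle) (hZ 𝒯 h𝒯 hle) }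
  right :=
    { extensions := fun A B Z h hA hZ 𝒯 h𝒯 hle =>
        h𝒯.left.extensions A B Z h (hA 𝒯 h𝒯 hle) (hZ 𝒯 h𝒯 hle)
      summands := fun M A B h hM 𝒯 h𝒯 hle => h𝒯.left.summands M A B h (hM 𝒯 h𝒯 hle)
      cones := fun A B Z h hA hB 𝒯 h𝒯 hle =>
        h𝒯.right.cones A B Z h (hA 𝒯 h𝒯 hle) (hB 𝒯 h𝒯 hle) }

/-- `ω` is a relative cogenerator in `𝒳`. -/
def RelCogenerator (ω 𝒳 : ObjectProperty C) : Prop :=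
  ω ≤ 𝒳 ∧ ∀ X : C, 𝒳 X → ∃ W X' : C, ω W ∧ 𝒳 X' ∧ HasConflation X W X'

/-- `ω` is a relative generator in `𝒳`. -/
def RelGenerator (ω 𝒳 : ObjectProperty C) : Prop :=
  ω ≤ 𝒳 ∧ ∀ X : C, 𝒳 X → ∃ X' W : C, ω W ∧ 𝒳 X' ∧ HasConflation X' W X

/-! ## Frobenius pairs, AB-contexts, cotorsion pairs

The infimum `⊓` of classes of objects is their intersection. -/

structure LeftFrobeniusPair (H : HigherExtensions.{w} C) (𝒳 ω : ObjectProperty C) : Prop where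
  leftThick : LeftThick 𝒳
  summands : ClosedUnderSummands ω
  injective : injDim H 𝒳 ω = 0
  cogenerator : RelCogenerator ω 𝒳

structure CutLeftFrobeniusPair (H : HigherExtensions.{w} C) (S 𝒳 ω : ObjectProperty C) :
    Prop where
  leftThick : LeftThick 𝒳
  frobenius : LeftFrobeniusPair H (𝒳 ⊓ S) (ω ⊓ S)
  projective : projDim H ω (ω ⊓ S) = 0
  generator : RelGenerator (ω ⊓ S) ω
  extensions : ClosedUnderExtensions ω
  summands : ClosedUnderSummands ω

/-- Left weak AB contexts cut on `S`. -/
structure CutLeftWeakABContext (H : HigherExtensions.{w} C) (S 𝒜 ℬ : ObjectProperty C) :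
    Prop where
  frobenius : CutLeftFrobeniusPair H S 𝒜 (𝒜 ⊓ ℬ)
  rightThick : RightThick (ℬ ⊓ S)
  le_wedge : ℬ ⊓ S ≤ wedge (𝒜 ⊓ S)

/-- Left `n`-cotorsion pairs cut on `S`, for `n ≥ 1`. -/
structure LeftCotorsionPairCut (H : HigherExtensions.{w} C) (n : ℕ)
    (S 𝒜 ℬ : ObjectProperty C) : Prop where
  summands : ClosedUnderSummands 𝒜
  vanish : ∀ i, 1 ≤ i → i ≤ n → H.Vanish i (𝒜 ⊓ S) ℬ
  complete : ∀ M : C, S M → ∃ K A : C, 𝒜 A ∧ resLE ℬ (n - 1) K ∧ HasConflation K A M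

/-- Right `n`-cotorsion pairs cut on `S`, for `n ≥ 1`. -/
structure RightCotorsionPairCut (H : HigherExtensions.{w} C) (n : ℕ)
    (S 𝒜 ℬ : ObjectProperty C) : Prop where
  summands : ClosedUnderSummands ℬ
  vanish : ∀ i, 1 ≤ i → i ≤ n → H.Vanish i 𝒜 (ℬ ⊓ S)
  complete : ∀ M : C, S M → ∃ B K : C, ℬ B ∧ coresLE 𝒜 (n - 1) K ∧ HasConflation M B K

/-- `n`-cotorsion pairs cut on `S`, for `n ≥ 1`. -/
structure CotorsionPairCut (H : HigherExtensions.{w} C) (n : ℕ)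
    (S 𝒜 ℬ : ObjectProperty C) : Prop where
  left : LeftCotorsionPairCut H n S 𝒜 ℬ
  right : RightCotorsionPairCut H n S 𝒜 ℬ

/-- Membership in the class of pairs `(ℱ, 𝒢)` that are 1-cotorsion pairs cut on `Thick(ℱ)` with
`id_ℱ(𝒢) = 0` and with `ℱ ∩ 𝒢 ∩ S` a relative generator and cogenerator in `ℱ ∩ 𝒢`. -/
structure MemP (H : HigherExtensions.{w} C) (S ℱ 𝒢 : ObjectProperty C) : Prop where
  cotorsion : CotorsionPairCut H 1 (Thick ℱ) ℱ 𝒢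
  injDim_eq : injDim H ℱ 𝒢 = 0
  generator : RelGenerator (ℱ ⊓ 𝒢 ⊓ S) (ℱ ⊓ 𝒢)
  cogenerator : RelCogenerator (ℱ ⊓ 𝒢 ⊓ S) (ℱ ⊓ 𝒢)

/-- The pairs `(ℱ, 𝒢)` with `MemP`. -/
abbrev PPairs (H : HigherExtensions.{w} C) (S : ObjectProperty C) :=
  {q : ObjectProperty C × ObjectProperty C // MemP H S q.1 q.2}

/-- The left weak AB contexts cut on `S`. -/
abbrev CPairs (H : HigherExtensions.{w} C) (S : ObjectProperty C) :=
  {q : ObjectProperty C × ObjectProperty C // CutLeftWeakABContext H S q.1 q.2}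

/-- `(𝒜, ℬ) ∼ (𝒜', ℬ')`: the pairs have the same `𝒜 ∩ S` and the same `𝒜 ∩ ℬ ∩ S`. -/
def pairSetoid (S : ObjectProperty C) :
    Setoid (ObjectProperty C × ObjectProperty C) where
  r q q' := q.1 ⊓ S = q'.1 ⊓ S ∧ q.1 ⊓ q.2 ⊓ S = q'.1 ⊓ q'.2 ⊓ S
  iseqv :=
    { refl := fun _ => ⟨rfl, rfl⟩
      symm := fun h => ⟨h.1.symm, h.2.symm⟩
      trans := fun h h' => ⟨h.1.trans h'.1, h.2.trans h'.2⟩ }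

instance pSetoid (H : HigherExtensions.{w} C) (S : ObjectProperty C) : Setoid (PPairs H S) :=
  (pairSetoid S).comap Subtype.val

instance cSetoid (H : HigherExtensions.{w} C) (S : ObjectProperty C) : Setoid (CPairs H S) :=
  (pairSetoid S).comap Subtype.val

end

end Extri

namespace Extri

open scoped ZeroObject
open ExtriangulatedCategory (s realize_hom s_zero s_sum et3 et3_op et4 et4_op)

/-! Both assignments preserve the two classes `𝒜 ⊓ S` and `𝒜 ⊓ ℬ ⊓ S` that define the equivalence
relations. Once each is known to land in the right collection, well-definedness on classes and
mutual inverseness are formal.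

Let `(ℱ, 𝒢)` be a cotorsion pair cut on `Thick ℱ`. An object of `Thick ℱ` lies in `ℱ` or in `𝒢` as
soon as its first extensions against the other class vanish, because its special approximation then
splits. With `injDim H ℱ 𝒢 = 0`, this makes `ℱ` left thick and `𝒢 ⊓ Thick ℱ` right thick. Finite
projective dimension relative to `𝒢` is a thick condition, so all of `Thick ℱ` satisfies it.
Induction on that dimension, with approximations by core objects, gives `wedge (ℱ ⊓ 𝒢) = 𝒢 ⊓ Thick
ℱ` (`CotorsionPairCut.wedge_core`). In particular, passing to the wedge does not change the core.
The relative generator and cogenerator then carry resolutions and coresolutions into `S`, whose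
thickness keeps the kernels and cokernels there.

Conversely, put `𝒳 = 𝒜 ⊓ S` and `𝒴 = ℬ ⊓ S`. Auslander-Buchweitz approximation
(`specialLeft_of_wedge`) lifts vanishing from the core to all of `𝒴` (`injDim_eq_zero_of_core`). The
objects with a special `𝒳`-precover form a thick class (`isThick_specialLeft`), which therefore
contains `Thick 𝒳`; this is the completeness required of a cotorsion pair.

Higher extensions enter only through a few vanishing statements, verified separately in the three
models. -/

lemma isIso_of_isIso_comp {C : Type u} [Category.{v} C] {M N : C} (b : M ⟶ N) (b' : N ⟶ M)
    [IsIso (b ≫ b')] [IsIso (b' ≫ b)] : IsIso b := by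
  have : IsSplitMono b := ⟨⟨⟨b' ≫ inv (b ≫ b'), by simp [← Category.assoc]⟩⟩⟩
  have : IsSplitEpi b := ⟨⟨⟨inv (b' ≫ b) ≫ b', by simp⟩⟩⟩
  exact isIso_of_mono_of_isSplitEpi b

/-! ### Exact sequences, splittings and base change for conflations -/

section Conflations

variable {C : Type u} [Category.{v} C] [Preadditive C] [HasZeroObject C] [HasBinaryBiproducts C]
  [ExtriangulatedCategory.{w} C]

local notation "𝔼" => ExtriangulatedCategory.E (C := C)

lemma push_zero {Z A A' : C} (a : A ⟶ A') : push 𝔼 a (0 : EE Z A) = 0 := map_zero _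

lemma pull_zero {Z Z' A : C} (c : Z' ⟶ Z) : pull 𝔼 c (0 : EE Z A) = 0 := map_zero _

lemma push_sub {Z A A' : C} (a : A ⟶ A') (δ ε : EE Z A) :
    push 𝔼 a (δ - ε) = push 𝔼 a δ - push 𝔼 a ε := map_sub _ _ _

lemma pull_sub {Z Z' A : C} (c : Z' ⟶ Z) (δ ε : EE Z A) :
    pull 𝔼 c (δ - ε) = pull 𝔼 c δ - pull 𝔼 c ε := map_sub _ _ _

lemma push_id {Z A : C} (δ : EE Z A) : push 𝔼 (𝟙 A) δ = δ := by
  simp [push]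

lemma pull_id {Z A : C} (δ : EE Z A) : pull 𝔼 (𝟙 Z) δ = δ := by
  simp [pull]

lemma push_comp {Z A A' A'' : C} (a : A ⟶ A') (a' : A' ⟶ A'') (δ : EE Z A) :
    push 𝔼 (a ≫ a') δ = push 𝔼 a' (push 𝔼 a δ) := by
  simp [push]

lemma pull_comp {Z Z' Z'' A : C} (c : Z' ⟶ Z) (c' : Z'' ⟶ Z') (δ : EE Z A) :
    pull 𝔼 (c' ≫ c) δ = pull 𝔼 c' (pull 𝔼 c δ) := by
  simp [pull]

lemma push_pull {Z Z' A A' : C} (a : A ⟶ A') (c : Z' ⟶ Z) (δ : EE Z A) :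
    push 𝔼 a (pull 𝔼 c δ) = pull 𝔼 c (push 𝔼 a δ) := by
  have := ConcreteCategory.congr_hom (((𝔼).map c.op).naturality a) δ
  exact this.symm

lemma sub_push {Z A A' : C} (a b : A ⟶ A') (δ : EE Z A) :
    push 𝔼 (a - b) δ = push 𝔼 a δ - push 𝔼 b δ := by
  have := ExtriangulatedCategory.additive_right (C := C) (op Z)
  simp [push, Functor.map_sub]

lemma sub_pull {Z Z' A : C} (c d : Z' ⟶ Z) (δ : EE Z A) :
    pull 𝔼 (c - d) δ = pull 𝔼 c δ - pull 𝔼 d δ := by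
  have := ExtriangulatedCategory.additive_left (C := C)
  simp [pull, Functor.map_sub]

lemma zero_push {Z A A' : C} (δ : EE Z A) : push 𝔼 (0 : A ⟶ A') δ = 0 := by
  rw [← sub_self (0 : A ⟶ A'), sub_push, sub_self]

lemma zero_pull {Z Z' A : C} (δ : EE Z A) : pull 𝔼 (0 : Z' ⟶ Z) δ = 0 := by
  rw [← sub_self (0 : Z' ⟶ Z), sub_pull, sub_self]

lemma exists_realizes {A Z : C} (δ : EE Z A) :
    ∃ (B : C) (x : A ⟶ B) (y : B ⟶ Z), Realizes δ x y := by
  obtain ⟨⟨B, x, y⟩, h⟩ := Quotient.exists_rep (s δ)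
  exact ⟨B, x, y, h.symm⟩

lemma realizes_zero (A Z : C) :
    Realizes (0 : EE Z A) (biprod.inl : A ⟶ A ⊞ Z) (biprod.snd : A ⊞ Z ⟶ Z) :=
  s_zero A Z

lemma Realizes.of_iso {A B B' Z : C} {δ : EE Z A} {x : A ⟶ B} {y : B ⟶ Z}
    (h : Realizes δ x y) (e : B ≅ B') : Realizes δ (x ≫ e.hom) (e.inv ≫ y) :=
  h.trans (Quotient.sound ⟨e, rfl, by simp⟩)

variable {A B Z : C} {δ : EE Z A} {x : A ⟶ B} {y : B ⟶ Z}

lemma Realizes.pull_eq_zero (h : Realizes δ x y) : pull 𝔼 y δ = 0 := by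
  obtain ⟨a, ha, -⟩ := et3_op _ _ _ _ _ _ (realizes_zero (0 : C) B) h
    (biprod.snd : (0 : C) ⊞ B ⟶ B) y rfl
  rw [← ha, push_zero]

lemma Realizes.push_eq_zero (h : Realizes δ x y) : push 𝔼 x δ = 0 := by
  obtain ⟨c, hc, -⟩ := et3 _ _ _ _ _ _ h (realizes_zero B (0 : C))
    x (biprod.inl : B ⟶ B ⊞ (0 : C)) rfl
  rw [hc, pull_zero]

lemma Realizes.exists_extension (h : Realizes δ x y) {A' : C} (f : A ⟶ A')
    (hf : push 𝔼 f δ = 0) : ∃ g : B ⟶ A', x ≫ g = f := by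
  obtain ⟨b, hb, -⟩ := realize_hom _ _ _ _ _ _ h (realizes_zero A' Z) f (𝟙 Z)
    (by rw [hf, pull_zero])
  exact ⟨b ≫ biprod.fst, by simp [reassoc_of% hb]⟩

lemma Realizes.exists_lift (h : Realizes δ x y) {Z' : C} (f : Z' ⟶ Z)
    (hf : pull 𝔼 f δ = 0) : ∃ g : Z' ⟶ B, g ≫ y = f := by
  obtain ⟨b, -, hb⟩ := realize_hom _ _ _ _ _ _ (realizes_zero A Z') h (𝟙 A) f
    (by rw [hf, push_zero])
  exact ⟨biprod.inr ≫ b, by simp [← hb]⟩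

/-- Since `x` kills `ε`, it extends over a realization of `ε`, and ET3 completes this to a morphism
of conflations that is the identity on `A`. Its third component is `t`. -/
lemma Realizes.exists_eq_pull (h : Realizes δ x y) {Z' : C} (ε : EE Z' A)
    (hε : push 𝔼 x ε = 0) : ∃ t : Z' ⟶ Z, ε = pull 𝔼 t δ := by
  obtain ⟨E, i, p, hi⟩ := exists_realizes ε
  obtain ⟨g, hg⟩ := hi.exists_extension x hε
  obtain ⟨c, hc, -⟩ := et3 _ _ _ _ _ _ hi h (𝟙 A) g (by simp [hg])
  exact ⟨c, by rw [← hc, push_id]⟩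

lemma Realizes.exists_eq_push (h : Realizes δ x y) {A' : C} (ε : EE Z A')
    (hε : pull 𝔼 y ε = 0) : ∃ t : A ⟶ A', ε = push 𝔼 t δ := by
  obtain ⟨E, i, p, hi⟩ := exists_realizes ε
  obtain ⟨g, hg⟩ := hi.exists_lift y hε
  obtain ⟨c, hc, -⟩ := et3_op _ _ _ _ _ _ h hi g (𝟙 Z) (by simp [hg])
  exact ⟨c, by rw [hc, pull_id]⟩

lemma Realizes.zero_section {e : A ⟶ B} {p : B ⟶ Z} (h : Realizes (0 : EE Z A) e p) :
    ∃ t : Z ⟶ B, t ≫ p = 𝟙 Z :=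
  h.exists_lift (𝟙 Z) (pull_zero _)

lemma Realizes.zero_retraction {e : A ⟶ B} {p : B ⟶ Z} (h : Realizes (0 : EE Z A) e p) :
    ∃ t : B ⟶ A, e ≫ t = 𝟙 A :=
  h.exists_extension (𝟙 A) (push_zero _)

/-- ET4 for the composite of `x` with an inflation realizing `ε` produces a conflation that realizes
`push y ε`, hence splits. Pulling the extension realized by the composite back along a section gives
the preimage. -/
lemma Realizes.exists_push_eq (h : Realizes δ x y) {X : C} (ε : EE X B)
    (hε : push 𝔼 y ε = 0) : ∃ ε' : EE X A, push 𝔼 x ε' = ε := by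
  obtain ⟨M, g, g', hg⟩ := exists_realizes ε
  obtain ⟨K, d, e, k, k', δ'', -, -, -, -, h2, -, h4⟩ := et4 _ _ _ _ _ _ h hg
  rw [hε] at h2
  obtain ⟨t, ht⟩ := Realizes.zero_section h2
  exact ⟨pull 𝔼 t δ'', by rw [push_pull, h4, ← pull_comp, ht, pull_id]⟩

lemma Realizes.exists_pull_eq (h : Realizes δ x y) {X : C} (ε : EE B X)
    (hε : pull 𝔼 x ε = 0) : ∃ ε' : EE Z X, pull 𝔼 y ε' = ε := by
  obtain ⟨M, g, g', hg⟩ := exists_realizes ε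
  obtain ⟨K, d, e, k, k', δ'', -, -, -, -, h2, -, h4⟩ := et4_op _ _ _ _ _ _ hg h
  rw [hε] at h2
  obtain ⟨t, ht⟩ := Realizes.zero_retraction h2
  exact ⟨push 𝔼 t δ'', by rw [← push_pull, ← h4, ← push_comp, ht, push_id]⟩

lemma Realizes.hasConflation (h : Realizes δ x y) : HasConflation A B Z := ⟨x, y, δ, h⟩

lemma hasConflation_biprod (A Z : C) : HasConflation A (A ⊞ Z) Z :=
  (realizes_zero A Z).hasConflation

lemma hasConflation_of_iso_biprod {A B Z : C} (e : B ≅ A ⊞ Z) : HasConflation A B Z :=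
  ((realizes_zero A Z).of_iso e.symm).hasConflation

lemma hasConflation_zero_left (M : C) : HasConflation (0 : C) M M :=
  hasConflation_of_iso_biprod
    { hom := biprod.inr
      inv := biprod.snd
      inv_hom_id := by ext; simp }

lemma hasConflation_zero_right (M : C) : HasConflation M M (0 : C) :=
  hasConflation_of_iso_biprod
    { hom := biprod.inl
      inv := biprod.fst
      inv_hom_id := by ext; simp }

lemma HasConflation.nonempty_iso_biprod {A B Z : C} (h : HasConflation A B Z)
    [Subsingleton (EE Z A)] : Nonempty (B ≅ A ⊞ Z) := by
  obtain ⟨x, y, δ, h⟩ := h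
  obtain rfl := Subsingleton.elim δ 0
  obtain ⟨b, -, -⟩ := Quotient.exact (h.symm.trans (s_zero A Z))
  exact ⟨b⟩

lemma HasConflation.biprod {A B Z A' B' Z' : C} (h : HasConflation A B Z)
    (h' : HasConflation A' B' Z') : HasConflation (A ⊞ A') (B ⊞ B') (Z ⊞ Z') := by
  obtain ⟨x, y, δ, h⟩ := h
  obtain ⟨x', y', δ', h'⟩ := h'
  exact ⟨_, _, _, s_sum _ _ _ _ _ _ h h'⟩

/-- Composition of two inflations. -/
lemma HasConflation.comp_inflation {A B D M F : C} (h : HasConflation A B D)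
    (h' : HasConflation B M F) : ∃ K, HasConflation A M K ∧ HasConflation D K F := by
  obtain ⟨x, y, δ, h⟩ := h
  obtain ⟨x', y', δ', h'⟩ := h'
  obtain ⟨K, d, e, k, k', δ'', -, -, -, h1, h2, -, -⟩ := et4 _ _ _ _ _ _ h h'
  exact ⟨K, ⟨_, _, _, h1⟩, ⟨_, _, _, h2⟩⟩

/-- Composition of two deflations. -/
lemma HasConflation.comp_deflation {D A B F M : C} (h : HasConflation D A B)
    (h' : HasConflation F B M) : ∃ K, HasConflation K A M ∧ HasConflation D K F := by
  obtain ⟨x, y, δ, h⟩ := h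
  obtain ⟨x', y', δ', h'⟩ := h'
  obtain ⟨K, d, e, k, k', δ'', -, -, -, h1, h2, -, -⟩ := et4_op _ _ _ _ _ _ h h'
  exact ⟨K, ⟨_, _, _, h1⟩, ⟨_, _, _, h2⟩⟩

lemma Realizes.comp_eq_zero (h : Realizes δ x y) : x ≫ y = 0 := by
  obtain ⟨c, -, hc⟩ := et3 _ _ _ _ _ _ (realizes_zero A (0 : C)) h (𝟙 A) (biprod.fst ≫ x)
    (by simp)
  have := biprod.inl ≫= hc
  simpa using this.symm

lemma Realizes.exists_desc (h : Realizes δ x y) {T : C} (f : B ⟶ T) (hf : x ≫ f = 0) :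
    ∃ g : Z ⟶ T, y ≫ g = f := by
  obtain ⟨c, -, hc⟩ := et3 _ _ _ _ _ _ h (realizes_zero (0 : C) T) 0 (f ≫ biprod.inr)
    (by simp [reassoc_of% hf])
  exact ⟨c, by simpa using hc⟩

/-- A section of the deflation of a split conflation is an inflation. -/
lemma Realizes.exists_swap {D K F : C} {d : D ⟶ K} {e : K ⟶ F}
    (h : Realizes (0 : EE F D) d e) (t : F ⟶ K) (ht : t ≫ e = 𝟙 F) :
    ∃ r : K ⟶ D, Realizes (0 : EE D F) t r := by
  obtain ⟨q, hq⟩ := h.zero_retraction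
  obtain ⟨p, hp⟩ := h.exists_desc (𝟙 K - q ≫ d) (by simp [Preadditive.comp_sub, reassoc_of% hq])
  let f : F ⊞ D ≅ K :=
    { hom := biprod.desc t d
      -- `𝟙 K - e ≫ t` is the projection along `t`; the retraction `q` of `d` reads off its
      -- coordinate in `D`.
      inv := biprod.lift e ((𝟙 K - e ≫ t) ≫ q)
      hom_inv_id := by
        ext <;> simp [ht, hq, h.comp_eq_zero, Preadditive.comp_sub, Preadditive.sub_comp,
          reassoc_of% ht, reassoc_of% h.comp_eq_zero]
      inv_hom_id := by
        have h1 : t = t ≫ q ≫ d + p := by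
          have := t ≫= hp
          rw [reassoc_of% ht, Preadditive.comp_sub] at this
          rw [this]
          simp
        have h2 : q ≫ d + e ≫ p = 𝟙 K := by rw [hp]; abel
        simp only [biprod.lift_desc, Preadditive.sub_comp, Category.assoc, Category.id_comp]
        nth_rw 1 [h1]
        rw [Preadditive.comp_add, ← h2]
        abel }
  exact ⟨f.inv ≫ biprod.snd, by simpa [f] using (realizes_zero F D).of_iso f⟩

/-- A retraction of the inflation of a split conflation is a deflation. -/
lemma Realizes.exists_swap_op {D K F : C} {d : D ⟶ K} {e : K ⟶ F}
    (h : Realizes (0 : EE F D) d e) (r : K ⟶ D) (hr : d ≫ r = 𝟙 D) :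
    ∃ t : F ⟶ K, Realizes (0 : EE D F) t r := by
  obtain ⟨q, hq⟩ := h.exists_desc (𝟙 K - r ≫ d) (by simp [Preadditive.comp_sub, reassoc_of% hr])
  have hqe : q ≫ e = 𝟙 F := by
    obtain ⟨p, hp⟩ := h.zero_section
    have h1 : e ≫ q ≫ e = e := by
      rw [reassoc_of% hq, Preadditive.sub_comp]
      simp [h.comp_eq_zero]
    have := p ≫= h1
    rwa [reassoc_of% hp, hp] at this
  have hqr : q ≫ r = 0 := by
    obtain ⟨p, hp⟩ := h.zero_section
    have h1 : e ≫ q ≫ r = 0 := by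
      rw [reassoc_of% hq, Preadditive.sub_comp]
      simp [hr]
    have := p ≫= h1
    rwa [reassoc_of% hp, comp_zero] at this
  let f : F ⊞ D ≅ K :=
    { hom := biprod.desc q d
      inv := biprod.lift e r
      hom_inv_id := by ext <;> simp [hqe, hqr, hr, h.comp_eq_zero]
      inv_hom_id := by simp [hq] }
  exact ⟨q, by simpa [f] using (realizes_zero F D).of_iso f⟩

/-- The difference `u - 𝟙 B` factors through `y` and is itself killed by `y`, so it squares to zero.
Thus `u` is unipotent with inverse `𝟙 B + 𝟙 B - u`, which replaces an appeal to the five lemma. -/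
lemma Realizes.isIso_of_comp_eq (h : Realizes δ x y) (u : B ⟶ B) (hx : x ≫ u = x)
    (hy : u ≫ y = y) : IsIso u := by
  obtain ⟨z, hz⟩ := h.exists_desc (u - 𝟙 B) (by simp [Preadditive.comp_sub, hx])
  have h0 : (u - 𝟙 B) ≫ (u - 𝟙 B) = 0 := by
    nth_rw 2 [← hz]
    rw [← Category.assoc, Preadditive.sub_comp, hy]
    simp
  simp only [Preadditive.comp_sub, Preadditive.sub_comp, Category.comp_id, Category.id_comp] at h0
  have h1 : u ≫ u = u + u - 𝟙 B := by
    rw [← sub_eq_zero, ← h0]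
    abel
  exact ⟨𝟙 B + 𝟙 B - u, by simp [Preadditive.comp_sub, h1],
    by simp [Preadditive.sub_comp, h1]⟩

lemma Realizes.push_iso (h : Realizes δ x y) {A' : C} (φ : A ≅ A') :
    Realizes (push 𝔼 φ.hom δ) (φ.inv ≫ x) y := by
  obtain ⟨M, x', y', h'⟩ := exists_realizes (push 𝔼 φ.hom δ)
  obtain ⟨b, hb₁, hb₂⟩ := realize_hom _ _ _ _ _ _ h h' φ.hom (𝟙 Z) (by rw [pull_id])
  obtain ⟨b', hb₁', hb₂'⟩ := realize_hom _ _ _ _ _ _ h' h φ.inv (𝟙 Z)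
    (by rw [pull_id, ← push_comp, φ.hom_inv_id, push_id])
  simp only [Category.comp_id] at hb₂ hb₂'
  have := h.isIso_of_comp_eq (b ≫ b') (by simp [reassoc_of% hb₁, hb₁'])
    (by rw [Category.assoc, ← hb₂', ← hb₂])
  have := h'.isIso_of_comp_eq (b' ≫ b) (by simp [reassoc_of% hb₁', hb₁])
    (by rw [Category.assoc, ← hb₂, ← hb₂'])
  have := isIso_of_isIso_comp b b'
  exact h'.trans (Quotient.sound ⟨(asIso b).symm, by simp [hb₁], by simp [hb₂]⟩)

lemma Realizes.pull_iso (h : Realizes δ x y) {Z' : C} (φ : Z' ≅ Z) :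
    Realizes (pull 𝔼 φ.hom δ) x (y ≫ φ.inv) := by
  obtain ⟨M, x', y', h'⟩ := exists_realizes (pull 𝔼 φ.hom δ)
  obtain ⟨b, hb₁, hb₂⟩ := realize_hom _ _ _ _ _ _ h h' (𝟙 A) φ.inv
    (by rw [push_id, ← pull_comp, φ.inv_hom_id, pull_id])
  obtain ⟨b', hb₁', hb₂'⟩ := realize_hom _ _ _ _ _ _ h' h (𝟙 A) φ.hom (by rw [push_id])
  simp only [Category.id_comp] at hb₁ hb₁'
  have := h.isIso_of_comp_eq (b ≫ b') (by rw [← Category.assoc, hb₁, hb₁'])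
    (by rw [Category.assoc, ← hb₂', ← Category.assoc, ← hb₂]; simp)
  have := h'.isIso_of_comp_eq (b' ≫ b) (by rw [← Category.assoc, hb₁', hb₁])
    (by rw [Category.assoc, ← hb₂, ← Category.assoc, ← hb₂']; simp)
  have := isIso_of_isIso_comp b b'
  exact h'.trans (Quotient.sound ⟨(asIso b).symm, by simp [← hb₁], by simp [hb₂]⟩)

lemma HasConflation.of_iso_left {A A' B Z : C} (h : HasConflation A B Z) (φ : A ≅ A') :
    HasConflation A' B Z := by
  obtain ⟨x, y, δ, h⟩ := h
  exact (h.push_iso φ).hasConflation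

lemma HasConflation.of_iso_right {A B Z Z' : C} (h : HasConflation A B Z) (φ : Z' ≅ Z) :
    HasConflation A B Z' := by
  obtain ⟨x, y, δ, h⟩ := h
  exact (h.pull_iso φ).hasConflation

lemma Realizes.nonempty_iso (h : Realizes δ x y) {B' : C} {x' : A ⟶ B'} {y' : B' ⟶ Z}
    (h' : Realizes δ x' y') : Nonempty (B ≅ B') := by
  obtain ⟨b, -, -⟩ := Quotient.exact (h.symm.trans h')
  exact ⟨b⟩

/-- Amalgamation of two inflations. -/
lemma HasConflation.pushout {A B₁ Z₁ B₂ Z₂ : C} (h₁ : HasConflation A B₁ Z₁)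
    (h₂ : HasConflation A B₂ Z₂) :
    ∃ M, HasConflation B₁ M Z₂ ∧ HasConflation B₂ M Z₁ := by
  obtain ⟨x₁, y₁, δ₁, h₁⟩ := h₁
  obtain ⟨x₂, y₂, δ₂, h₂⟩ := h₂
  obtain ⟨M, g, g', hg⟩ := exists_realizes (push 𝔼 x₁ δ₂)
  obtain ⟨K, d, e, k, k', ε, -, -, -, hε, h0, hd, he⟩ := et4 _ _ _ _ _ _ h₁ hg
  rw [← push_comp, h₁.comp_eq_zero, zero_push] at h0
  obtain ⟨t, ht⟩ := Realizes.zero_section h0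
  -- A section `t` pulls `ε` back to `δ₂` only up to a class killed by `x₁`, that is, a pullback of
  -- `δ₁`. Correcting by `t' ≫ d` makes the pullback exactly `δ₂`. The corrected section is again an
  -- inflation, and ET4 dual then exhibits `B₂`, up to isomorphism, as the fibre of `M ⟶ Z₁`.
  obtain ⟨t', ht'⟩ := h₁.exists_eq_pull (pull 𝔼 t ε - δ₂) (by
    rw [push_sub, push_pull, he, ← pull_comp, ht, pull_id, sub_self])
  obtain ⟨r, hr⟩ := Realizes.exists_swap h0 (t - t' ≫ d)
    (by simp [Preadditive.sub_comp, ht, Realizes.comp_eq_zero h0])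
  obtain ⟨L, a, b, k₁, k₂, η, -, -, -, h3, h4, -, -⟩ := et4_op _ _ _ _ _ _ hε hr
  rw [sub_pull, pull_comp, hd, ← ht', sub_sub_cancel] at h4
  obtain ⟨φ⟩ := Realizes.nonempty_iso h4 h₂
  exact ⟨M, hg.hasConflation, (Realizes.hasConflation h3).of_iso_left φ⟩

/-- Fibre product of two deflations. -/
lemma HasConflation.pullback {A₁ B₁ A₂ B₂ Z : C} (h₁ : HasConflation A₁ B₁ Z)
    (h₂ : HasConflation A₂ B₂ Z) :
    ∃ M, HasConflation A₁ M B₂ ∧ HasConflation A₂ M B₁ := by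
  obtain ⟨x₁, y₁, δ₁, h₁⟩ := h₁
  obtain ⟨x₂, y₂, δ₂, h₂⟩ := h₂
  obtain ⟨M, g, g', hg⟩ := exists_realizes (pull 𝔼 y₁ δ₂)
  obtain ⟨K, d, e, k, k', ε, -, -, -, hε, h0, hd, he⟩ := et4_op _ _ _ _ _ _ hg h₁
  rw [← pull_comp, h₁.comp_eq_zero, zero_pull] at h0
  obtain ⟨t, ht⟩ := Realizes.zero_retraction h0
  obtain ⟨t', ht'⟩ := h₁.exists_eq_push (push 𝔼 t ε - δ₂) (by
    rw [pull_sub, ← push_pull, ← he, ← push_comp, ht, push_id, sub_self])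
  obtain ⟨r, hr⟩ := Realizes.exists_swap_op h0 (t - e ≫ t')
    (by simp [Preadditive.comp_sub, ht, reassoc_of% Realizes.comp_eq_zero h0])
  obtain ⟨L, a, b, k₁, k₂, η, -, -, -, h3, h4, -, -⟩ := et4 _ _ _ _ _ _ hr hε
  rw [sub_push, push_comp, ← hd, ← ht', sub_sub_cancel] at h4
  obtain ⟨φ⟩ := Realizes.nonempty_iso h4 h₂
  exact ⟨M, (Realizes.hasConflation h3).of_iso_right φ.symm, hg.hasConflation⟩

end Conflations
end Extri

namespace Extri

open scoped ZeroObject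

/-! ### Vanishing from the long exact sequences: Yoneda extensions -/

section AbelianExt

open Abelian

variable {C : Type u} [Category.{v} C] [Abelian C] [HasExt.{w} C] {S : ShortComplex C}

lemma subsingleton_ext_mid_left (hS : S.ShortExact) {Y : C} {n : ℕ}
    (h₁ : Subsingleton (Ext S.X₁ Y n)) (h₃ : Subsingleton (Ext S.X₃ Y n)) :
    Subsingleton (Ext S.X₂ Y n) :=
  subsingleton_of_forall_eq 0 fun e => by
    obtain ⟨f, rfl⟩ := Ext.contravariant_sequence_exact₂ hS Y e (Subsingleton.elim _ _)
    rw [Subsingleton.elim f 0, Ext.comp_zero]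

lemma subsingleton_ext_cocone_left (hS : S.ShortExact) {Y : C} {n : ℕ}
    (h₂ : Subsingleton (Ext S.X₂ Y n)) (h₃ : Subsingleton (Ext S.X₃ Y (n + 1))) :
    Subsingleton (Ext S.X₁ Y n) :=
  subsingleton_of_forall_eq 0 fun e => by
    obtain ⟨f, rfl⟩ := Ext.contravariant_sequence_exact₁ hS Y e (add_comm 1 n)
      (Subsingleton.elim _ _)
    rw [Subsingleton.elim f 0, Ext.comp_zero]

lemma subsingleton_ext_cone_left (hS : S.ShortExact) {Y : C} {n : ℕ}
    (h₁ : Subsingleton (Ext S.X₁ Y n)) (h₂ : Subsingleton (Ext S.X₂ Y (n + 1))) :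
    Subsingleton (Ext S.X₃ Y (n + 1)) :=
  subsingleton_of_forall_eq 0 fun e => by
    obtain ⟨f, rfl⟩ := Ext.contravariant_sequence_exact₃ hS Y e (Subsingleton.elim _ _)
      (add_comm 1 n)
    rw [Subsingleton.elim f 0, Ext.comp_zero]

lemma subsingleton_ext_mid_right (hS : S.ShortExact) {X : C} {n : ℕ}
    (h₁ : Subsingleton (Ext X S.X₁ n)) (h₃ : Subsingleton (Ext X S.X₃ n)) :
    Subsingleton (Ext X S.X₂ n) :=
  subsingleton_of_forall_eq 0 fun e => by
    obtain ⟨f, rfl⟩ := Ext.covariant_sequence_exact₂ X hS e (Subsingleton.elim _ _)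
    rw [Subsingleton.elim f 0, Ext.zero_comp]

lemma subsingleton_ext_cone_right (hS : S.ShortExact) {X : C} {n : ℕ}
    (h₂ : Subsingleton (Ext X S.X₂ n)) (h₁ : Subsingleton (Ext X S.X₁ (n + 1))) :
    Subsingleton (Ext X S.X₃ n) :=
  subsingleton_of_forall_eq 0 fun e => by
    obtain ⟨f, rfl⟩ := Ext.covariant_sequence_exact₃ X hS e rfl (Subsingleton.elim _ _)
    rw [Subsingleton.elim f 0, Ext.zero_comp]

lemma subsingleton_ext_retract_left {X X' Y : C} (i : X' ⟶ X) (r : X ⟶ X') (hir : i ≫ r = 𝟙 X')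
    {n : ℕ} (h : Subsingleton (Ext X Y n)) : Subsingleton (Ext X' Y n) :=
  subsingleton_of_forall_eq 0 fun e => by
    rw [← Ext.mk₀_id_comp e, ← hir, ← Ext.mk₀_comp_mk₀_assoc,
      Subsingleton.elim ((Ext.mk₀ r).comp e _) 0, Ext.comp_zero]

lemma exists_section_of_subsingleton_ext (hS : S.ShortExact)
    (h : Subsingleton (Ext S.X₃ S.X₁ 1)) : ∃ t : S.X₃ ⟶ S.X₂, t ≫ S.g = 𝟙 S.X₃ := by
  obtain ⟨f, hf⟩ := Ext.covariant_sequence_exact₃ S.X₃ hS (Ext.mk₀ (𝟙 S.X₃)) (zero_add 1)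
    (Subsingleton.elim _ _)
  obtain ⟨t, rfl⟩ := Ext.addEquiv₀.symm.surjective f
  refine ⟨t, ?_⟩
  have := Ext.addEquiv₀.symm.injective (a₁ := t ≫ S.g) (a₂ := 𝟙 S.X₃)
  exact this (by simpa using hf)

end AbelianExt

/-! ### Vanishing in triangulated categories: morphisms into shifts -/

section TriangulatedHom

open Pretriangulated

variable {C : Type u} [Category.{v} C] [Preadditive C] [HasShift C ℤ]

lemma subsingleton_hom_of_shift {X Y : C} {n : ℕ}
    (h : Subsingleton ((shiftFunctor C (1 : ℤ)).obj X ⟶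
      (shiftFunctor C ((n + 1 : ℕ) : ℤ)).obj Y)) :
    Subsingleton (X ⟶ (shiftFunctor C (n : ℤ)).obj Y) := by
  let e := (shiftFunctorAdd' C (n : ℤ) 1 ((n + 1 : ℕ) : ℤ) (by simp)).app Y
  refine subsingleton_of_forall_eq 0 fun f => ?_
  apply (shiftFunctor C (1 : ℤ)).map_injective
  rw [← cancel_mono e.inv]
  exact Subsingleton.elim _ _

variable [∀ n : ℤ, (shiftFunctor C n).Additive]

lemma subsingleton_hom_shift_succ {X Y : C} {n : ℕ}
    (h : Subsingleton (X ⟶ (shiftFunctor C (n : ℤ)).obj Y)) :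
    Subsingleton ((shiftFunctor C (1 : ℤ)).obj X ⟶ (shiftFunctor C ((n + 1 : ℕ) : ℤ)).obj Y) := by
  let e := (shiftFunctorAdd' C (n : ℤ) 1 ((n + 1 : ℕ) : ℤ) (by simp)).app Y
  refine subsingleton_of_forall_eq 0 fun f => ?_
  obtain ⟨g, hg⟩ := (shiftFunctor C (1 : ℤ)).map_surjective (f ≫ e.hom)
  rw [Subsingleton.elim g 0, Functor.map_zero] at hg
  rw [← cancel_mono e.hom, ← hg, zero_comp]

variable [HasZeroObject C] [Pretriangulated C] {T : Triangle C}

lemma subsingleton_hom_mid_left (hT : T ∈ distTriang C) {Y : C}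
    (h₁ : Subsingleton (T.obj₁ ⟶ Y)) (h₃ : Subsingleton (T.obj₃ ⟶ Y)) :
    Subsingleton (T.obj₂ ⟶ Y) :=
  subsingleton_of_forall_eq 0 fun f => by
    obtain ⟨g, rfl⟩ := Triangle.yoneda_exact₂ T hT f (Subsingleton.elim _ _)
    rw [Subsingleton.elim g 0, comp_zero]

lemma subsingleton_hom_mid_right (hT : T ∈ distTriang C) {X : C}
    (h₁ : Subsingleton (X ⟶ T.obj₁)) (h₃ : Subsingleton (X ⟶ T.obj₃)) :
    Subsingleton (X ⟶ T.obj₂) :=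
  subsingleton_of_forall_eq 0 fun f => by
    obtain ⟨g, rfl⟩ := Triangle.coyoneda_exact₂ T hT f (Subsingleton.elim _ _)
    rw [Subsingleton.elim g 0, zero_comp]

lemma subsingleton_hom_cone_left (hT : T ∈ distTriang C) {Y : C} {n : ℕ}
    (h₁ : Subsingleton (T.obj₁ ⟶ (shiftFunctor C (n : ℤ)).obj Y))
    (h₂ : Subsingleton (T.obj₂ ⟶ (shiftFunctor C ((n + 1 : ℕ) : ℤ)).obj Y)) :
    Subsingleton (T.obj₃ ⟶ (shiftFunctor C ((n + 1 : ℕ) : ℤ)).obj Y) :=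
  subsingleton_hom_mid_left (rot_of_distTriang _ hT) h₂ (subsingleton_hom_shift_succ h₁)

lemma subsingleton_hom_cocone_left (hT : T ∈ distTriang C) {Y : C} {n : ℕ}
    (h₂ : Subsingleton (T.obj₂ ⟶ (shiftFunctor C (n : ℤ)).obj Y))
    (h₃ : Subsingleton (T.obj₃ ⟶ (shiftFunctor C ((n + 1 : ℕ) : ℤ)).obj Y)) :
    Subsingleton (T.obj₁ ⟶ (shiftFunctor C (n : ℤ)).obj Y) :=
  subsingleton_hom_of_shift (subsingleton_hom_mid_left
    (rot_of_distTriang _ (rot_of_distTriang _ hT)) h₃ (subsingleton_hom_shift_succ h₂))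

lemma subsingleton_hom_shift_mid_right (hT : T ∈ distTriang C) {X : C} (n : ℤ)
    (h₁ : Subsingleton (X ⟶ (shiftFunctor C n).obj T.obj₁))
    (h₃ : Subsingleton (X ⟶ (shiftFunctor C n).obj T.obj₃)) :
    Subsingleton (X ⟶ (shiftFunctor C n).obj T.obj₂) :=
  subsingleton_hom_mid_right (Triangle.shift_distinguished T hT n) h₁ h₃

lemma subsingleton_hom_shift_cone_right (hT : T ∈ distTriang C) {X : C} {n : ℕ}
    (h₂ : Subsingleton (X ⟶ (shiftFunctor C (n : ℤ)).obj T.obj₂))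
    (h₁ : Subsingleton (X ⟶ (shiftFunctor C ((n + 1 : ℕ) : ℤ)).obj T.obj₁)) :
    Subsingleton (X ⟶ (shiftFunctor C (n : ℤ)).obj T.obj₃) := by
  refine subsingleton_hom_shift_mid_right (rot_of_distTriang _ hT) n h₂ ?_
  let e := (shiftFunctorAdd' C 1 (n : ℤ) ((n + 1 : ℕ) : ℤ) (by push_cast; ring)).app T.obj₁
  exact subsingleton_of_forall_eq 0 fun f => (cancel_mono e.inv).1 (Subsingleton.elim _ _)

end TriangulatedHom

/-! ### Dimension shifting with enough projectives and injectives -/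

section EnoughHom

variable {C : Type u} [Category.{v} C] [Preadditive C] [HasZeroObject C] [HasBinaryBiproducts C]
  [ExtriangulatedCategory.{w} C]

local notation "𝔼" => ExtriangulatedCategory.E (C := C)

variable {A B Z : C}

lemma subsingleton_EE_of_forall_section
    (h : ∀ (B : C) (x : A ⟶ B) (y : B ⟶ Z), Conflation x y → ∃ t : Z ⟶ B, t ≫ y = 𝟙 Z) :
    Subsingleton (EE Z A) :=
  subsingleton_of_forall_eq 0 fun δ => by
    obtain ⟨B, x, y, hδ⟩ := exists_realizes δ
    obtain ⟨t, ht⟩ := h B x y ⟨δ, hδ⟩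
    rw [← pull_id δ, ← ht, pull_comp, hδ.pull_eq_zero, pull_zero]

lemma EProjective.subsingleton_EE {P : C} (hP : EProjective P) (A : C) :
    Subsingleton (EE P A) :=
  subsingleton_EE_of_forall_section fun _ x y h => hP x y h (𝟙 P)

lemma EInjective.subsingleton_EE {I : C} (hI : EInjective I) (Z : C) :
    Subsingleton (EE Z I) :=
  subsingleton_of_forall_eq 0 fun δ => by
    obtain ⟨B, x, y, hδ⟩ := exists_realizes δ
    obtain ⟨t, ht⟩ := hI x y ⟨δ, hδ⟩ (𝟙 I)
    rw [← push_id δ, ← ht, push_comp, hδ.push_eq_zero, push_zero]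

lemma subsingleton_EE_mid_left (h : HasConflation A B Z) {Y : C} (h₁ : Subsingleton (EE A Y))
    (h₃ : Subsingleton (EE Z Y)) : Subsingleton (EE B Y) :=
  subsingleton_of_forall_eq 0 fun ε => by
    obtain ⟨x, y, δ, h⟩ := h
    obtain ⟨ε', rfl⟩ := h.exists_pull_eq ε (Subsingleton.elim _ _)
    rw [Subsingleton.elim ε' 0, pull_zero]

lemma subsingleton_EE_mid_right (h : HasConflation A B Z) {X : C} (h₁ : Subsingleton (EE X A))
    (h₃ : Subsingleton (EE X Z)) : Subsingleton (EE X B) :=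
  subsingleton_of_forall_eq 0 fun ε => by
    obtain ⟨x, y, δ, h⟩ := h
    obtain ⟨ε', rfl⟩ := h.exists_push_eq ε (Subsingleton.elim _ _)
    rw [Subsingleton.elim ε' 0, push_zero]

/-- Dimension shift along `Y ⟶ I ⟶ Y'`: a class in `𝔼(A, Y)` comes from a map `A ⟶ Y'`. This map
extends to `B` because `𝔼(Z, Y')` vanishes, so the class is pulled back from `𝔼(B, Y)`, which is
zero. -/
lemma subsingleton_EE_cocone_left (h : HasConflation A B Z) {Y I Y' : C}
    (hI : Subsingleton (EE A I)) (hY : HasConflation Y I Y') (h₂ : Subsingleton (EE B Y))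
    (h₃ : Subsingleton (EE Z Y')) : Subsingleton (EE A Y) :=
  subsingleton_of_forall_eq 0 fun ε => by
    obtain ⟨x, y, δ, h⟩ := h
    obtain ⟨i, p, σ, hσ⟩ := hY
    obtain ⟨f, rfl⟩ := hσ.exists_eq_pull ε (Subsingleton.elim _ _)
    obtain ⟨g, rfl⟩ := h.exists_extension f (Subsingleton.elim _ _)
    rw [pull_comp, Subsingleton.elim (pull _ g σ) 0, pull_zero]

lemma subsingleton_EE_cone_left (h : HasConflation A B Z) {Y I Y' : C}
    (hI : Subsingleton (EE Z I)) (hY : HasConflation Y I Y') (h₁ : Subsingleton (EE A Y))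
    (h₂ : Subsingleton (EE B Y')) : Subsingleton (EE Z Y') :=
  subsingleton_of_forall_eq 0 fun ε => by
    obtain ⟨x, y, δ, h⟩ := h
    obtain ⟨i, p, σ, hσ⟩ := hY
    obtain ⟨f, rfl⟩ := h.exists_eq_push ε (Subsingleton.elim _ _)
    obtain ⟨g, rfl⟩ := hσ.exists_lift f (Subsingleton.elim _ _)
    rw [push_comp, Subsingleton.elim (push _ g δ) 0, push_zero]

lemma subsingleton_EE_cone_right (h : HasConflation A B Z) {X P X' : C}
    (hP : Subsingleton (EE P Z)) (hX : HasConflation X' P X) (h₂ : Subsingleton (EE X B))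
    (h₁ : Subsingleton (EE X' A)) : Subsingleton (EE X Z) :=
  subsingleton_of_forall_eq 0 fun ε => by
    obtain ⟨x, y, δ, h⟩ := h
    obtain ⟨i, p, σ, hσ⟩ := hX
    obtain ⟨f, rfl⟩ := hσ.exists_eq_push ε (Subsingleton.elim _ _)
    obtain ⟨g, rfl⟩ := h.exists_lift f (Subsingleton.elim _ _)
    rw [push_comp, Subsingleton.elim (push _ g σ) 0, push_zero]

lemma subsingleton_EE_retract_left {X X' Y : C} (i : X' ⟶ X) (r : X ⟶ X') (hir : i ≫ r = 𝟙 X')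
    (h : Subsingleton (EE X Y)) : Subsingleton (EE X' Y) :=
  subsingleton_of_forall_eq 0 fun ε => by
    rw [← pull_id ε, ← hir, pull_comp, Subsingleton.elim (pull _ r ε) 0, pull_zero]

lemma exists_cosyzygy_conflation (hinj : EnoughEInjectives C) (k : ℕ) (Y : C) :
    ∃ I : C, EInjective I ∧
      HasConflation (cosyzygyIter hinj k Y) I (cosyzygyIter hinj (k + 1) Y) :=
  ⟨_, (hinj (cosyzygyIter hinj k Y)).choose_spec.choose_spec⟩

/-- Dimension shift: cosyzygies of the second variable become syzygies of the first one. -/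
lemma subsingleton_EE_cosyzygyIter_succ_iff (hinj : EnoughEInjectives C) {X P X' : C}
    (hP : EProjective P) (h : HasConflation X' P X) (k : ℕ) (Y : C) :
    Subsingleton (EE X (cosyzygyIter hinj (k + 1) Y)) ↔
      Subsingleton (EE X' (cosyzygyIter hinj k Y)) := by
  obtain ⟨I, hI, hY⟩ := exists_cosyzygy_conflation hinj k Y
  exact ⟨subsingleton_EE_cocone_left h (hI.subsingleton_EE _) hY (hP.subsingleton_EE _),
    fun h₁ => subsingleton_EE_cone_left h (hI.subsingleton_EE _) hY h₁ (hP.subsingleton_EE _)⟩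

/-- The chosen cosyzygies of `A`, `B` and `Z` are not known to form a conflation. The cosyzygies are
therefore traded one at a time for syzygies of `X`, until the given conflation itself applies. -/
lemma subsingleton_EE_cosyzygyIter_mid_right (hproj : EnoughEProjectives C)
    (hinj : EnoughEInjectives C) (h : HasConflation A B Z) (k : ℕ) {X : C}
    (h₁ : Subsingleton (EE X (cosyzygyIter hinj k A)))
    (h₃ : Subsingleton (EE X (cosyzygyIter hinj k Z))) :
    Subsingleton (EE X (cosyzygyIter hinj k B)) := by
  induction k generalizing X with
  | zero => exact subsingleton_EE_mid_right h h₁ h₃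
  | succ k ih =>
    obtain ⟨X', P, hP, hX⟩ := hproj X
    rw [subsingleton_EE_cosyzygyIter_succ_iff hinj hP hX] at h₁ h₃ ⊢
    exact ih h₁ h₃

lemma subsingleton_EE_cosyzygyIter_cone_right (hproj : EnoughEProjectives C)
    (hinj : EnoughEInjectives C) (h : HasConflation A B Z) (k : ℕ) {X : C}
    (h₂ : Subsingleton (EE X (cosyzygyIter hinj k B)))
    (h₁ : Subsingleton (EE X (cosyzygyIter hinj (k + 1) A))) :
    Subsingleton (EE X (cosyzygyIter hinj k Z)) := by
  induction k generalizing X with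
  | zero =>
    obtain ⟨X', P, hP, hX⟩ := hproj X
    rw [subsingleton_EE_cosyzygyIter_succ_iff hinj hP hX] at h₁
    exact subsingleton_EE_cone_right h (hP.subsingleton_EE _) hX h₂ h₁
  | succ k ih =>
    obtain ⟨X', P, hP, hX⟩ := hproj X
    rw [subsingleton_EE_cosyzygyIter_succ_iff hinj hP hX] at h₁ h₂ ⊢
    exact ih h₂ h₁

end EnoughHom

/-! ### Vanishing statements uniform in the three models -/

namespace HigherExtensions

variable {C : Type u} [Category.{v} C] [Preadditive C] [HasZeroObject C] [HasBinaryBiproducts C]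
  [ExtriangulatedCategory.{w} C]

lemma subsingleton_abelian_iff (hab : IsAbelianCat C)
    (hc : ∀ {A B Z : C} (x : A ⟶ B) (y : B ⟶ Z),
        Conflation x y ↔ ∃ zero : x ≫ y = 0, (ShortComplex.mk x y zero).ShortExact)
    (n : ℕ) (X Y : C) :
    Subsingleton ((abelian hab hc).ext n X Y) ↔ Subsingleton (abelianExt hab n X Y) :=
  Equiv.ulift.subsingleton_congr

lemma subsingleton_triangulated_iff [HasShift C ℤ] [∀ n : ℤ, (shiftFunctor C n).Additive]
    [Pretriangulated C] [IsTriangulated C]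
    (φ : ∀ Z A : C, EE Z A ≃+ (Z ⟶ (shiftFunctor C (1 : ℤ)).obj A)) (h₁ h₂ h₃)
    (n : ℕ) (X Y : C) :
    Subsingleton ((triangulated φ h₁ h₂ h₃).ext n X Y) ↔
      Subsingleton (X ⟶ (shiftFunctor C (n : ℤ)).obj Y) :=
  Equiv.ulift.subsingleton_congr

lemma subsingleton_enough_iff (hproj : EnoughEProjectives C) (hinj : EnoughEInjectives C)
    (n : ℕ) (X Y : C) :
    Subsingleton ((enough hproj hinj).ext (n + 1) X Y) ↔
      Subsingleton (EE X (cosyzygyIter hinj n Y)) :=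
  Equiv.ulift.subsingleton_congr

variable (H : HigherExtensions.{w} C) {A B Z : C}

/-- In the abelian model only the conflations are prescribed, with no comparison between `𝔼` and
Yoneda's group. The argument there passes through splitting: every conflation with these ends has a
section, which forces its class to be zero. -/
lemma subsingleton_EE {X Y : C} (h : Subsingleton (H.ext 1 X Y)) : Subsingleton (EE X Y) := by
  cases H with
  | abelian hab hc =>
    rw [subsingleton_abelian_iff hab hc] at h
    let := hab.toAbelian
    let : HasExt.{max u v} C := HasExt.standard C
    refine subsingleton_EE_of_forall_section fun B x y hxy => ?_
    obtain ⟨zero, hS⟩ := (hc x y).1 hxy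
    exact exists_section_of_subsingleton_ext hS h
  | triangulated φ h₁ h₂ h₃ =>
    rw [subsingleton_triangulated_iff] at h
    exact ((φ X Y).toEquiv.subsingleton_congr).2 h
  | enough hproj hinj => exact (subsingleton_enough_iff hproj hinj 0 X Y).1 h

lemma subsingleton_mid_left (h : HasConflation A B Z) {Y : C} {n : ℕ} (hn : 1 ≤ n)
    (hA : Subsingleton (H.ext n A Y)) (hZ : Subsingleton (H.ext n Z Y)) :
    Subsingleton (H.ext n B Y) := by
  cases H with
  | abelian hab hc =>
    rw [subsingleton_abelian_iff hab hc] at hA hZ ⊢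
    let := hab.toAbelian
    let : HasExt.{max u v} C := HasExt.standard C
    obtain ⟨x, y, hxy⟩ := h
    obtain ⟨zero, hS⟩ := (hc x y).1 hxy
    exact subsingleton_ext_mid_left hS hA hZ
  | triangulated φ h₁ h₂ h₃ =>
    rw [subsingleton_triangulated_iff] at hA hZ ⊢
    obtain ⟨x, y, δ, hxy⟩ := h
    exact subsingleton_hom_mid_left ((h₃ _ _ _).1 hxy) hA hZ
  | enough hproj hinj =>
    obtain ⟨n, rfl⟩ := Nat.exists_eq_add_of_le' hn
    rw [subsingleton_enough_iff] at hA hZ ⊢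
    exact subsingleton_EE_mid_left h hA hZ

lemma subsingleton_cocone_left (h : HasConflation A B Z) {Y : C} {n : ℕ} (hn : 1 ≤ n)
    (hB : Subsingleton (H.ext n B Y)) (hZ : Subsingleton (H.ext (n + 1) Z Y)) :
    Subsingleton (H.ext n A Y) := by
  cases H with
  | abelian hab hc =>
    rw [subsingleton_abelian_iff hab hc] at hB hZ ⊢
    let := hab.toAbelian
    let : HasExt.{max u v} C := HasExt.standard C
    obtain ⟨x, y, hxy⟩ := h
    obtain ⟨zero, hS⟩ := (hc x y).1 hxy
    exact subsingleton_ext_cocone_left hS hB hZ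
  | triangulated φ h₁ h₂ h₃ =>
    rw [subsingleton_triangulated_iff] at hB hZ ⊢
    obtain ⟨x, y, δ, hxy⟩ := h
    exact subsingleton_hom_cocone_left ((h₃ _ _ _).1 hxy) hB hZ
  | enough hproj hinj =>
    obtain ⟨n, rfl⟩ := Nat.exists_eq_add_of_le' hn
    rw [subsingleton_enough_iff] at hB hZ ⊢
    obtain ⟨I, hI, hY⟩ := exists_cosyzygy_conflation hinj n Y
    exact subsingleton_EE_cocone_left h (hI.subsingleton_EE _) hY hB hZ

lemma subsingleton_cone_left (h : HasConflation A B Z) {Y : C} {n : ℕ} (hn : 1 ≤ n)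
    (hA : Subsingleton (H.ext n A Y)) (hB : Subsingleton (H.ext (n + 1) B Y)) :
    Subsingleton (H.ext (n + 1) Z Y) := by
  cases H with
  | abelian hab hc =>
    rw [subsingleton_abelian_iff hab hc] at hA hB ⊢
    let := hab.toAbelian
    let : HasExt.{max u v} C := HasExt.standard C
    obtain ⟨x, y, hxy⟩ := h
    obtain ⟨zero, hS⟩ := (hc x y).1 hxy
    exact subsingleton_ext_cone_left hS hA hB
  | triangulated φ h₁ h₂ h₃ =>
    rw [subsingleton_triangulated_iff] at hA hB ⊢
    obtain ⟨x, y, δ, hxy⟩ := h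
    exact subsingleton_hom_cone_left ((h₃ _ _ _).1 hxy) hA hB
  | enough hproj hinj =>
    obtain ⟨n, rfl⟩ := Nat.exists_eq_add_of_le' hn
    rw [subsingleton_enough_iff] at hA hB ⊢
    obtain ⟨I, hI, hY⟩ := exists_cosyzygy_conflation hinj n Y
    exact subsingleton_EE_cone_left h (hI.subsingleton_EE _) hY hA hB

lemma subsingleton_mid_right (h : HasConflation A B Z) {X : C} {n : ℕ} (hn : 1 ≤ n)
    (hA : Subsingleton (H.ext n X A)) (hZ : Subsingleton (H.ext n X Z)) :
    Subsingleton (H.ext n X B) := by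
  cases H with
  | abelian hab hc =>
    rw [subsingleton_abelian_iff hab hc] at hA hZ ⊢
    let := hab.toAbelian
    let : HasExt.{max u v} C := HasExt.standard C
    obtain ⟨x, y, hxy⟩ := h
    obtain ⟨zero, hS⟩ := (hc x y).1 hxy
    exact subsingleton_ext_mid_right hS hA hZ
  | triangulated φ h₁ h₂ h₃ =>
    rw [subsingleton_triangulated_iff] at hA hZ ⊢
    obtain ⟨x, y, δ, hxy⟩ := h
    exact subsingleton_hom_shift_mid_right ((h₃ _ _ _).1 hxy) n hA hZ
  | enough hproj hinj =>
    obtain ⟨n, rfl⟩ := Nat.exists_eq_add_of_le' hn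
    rw [subsingleton_enough_iff] at hA hZ ⊢
    exact subsingleton_EE_cosyzygyIter_mid_right hproj hinj h n hA hZ

lemma subsingleton_cone_right (h : HasConflation A B Z) {X : C} {n : ℕ} (hn : 1 ≤ n)
    (hB : Subsingleton (H.ext n X B)) (hA : Subsingleton (H.ext (n + 1) X A)) :
    Subsingleton (H.ext n X Z) := by
  cases H with
  | abelian hab hc =>
    rw [subsingleton_abelian_iff hab hc] at hB hA ⊢
    let := hab.toAbelian
    let : HasExt.{max u v} C := HasExt.standard C
    obtain ⟨x, y, hxy⟩ := h
    obtain ⟨zero, hS⟩ := (hc x y).1 hxy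
    exact subsingleton_ext_cone_right hS hB hA
  | triangulated φ h₁ h₂ h₃ =>
    rw [subsingleton_triangulated_iff] at hB hA ⊢
    obtain ⟨x, y, δ, hxy⟩ := h
    exact subsingleton_hom_shift_cone_right ((h₃ _ _ _).1 hxy) hB hA
  | enough hproj hinj =>
    obtain ⟨n, rfl⟩ := Nat.exists_eq_add_of_le' hn
    rw [subsingleton_enough_iff] at hB hA ⊢
    exact subsingleton_EE_cosyzygyIter_cone_right hproj hinj h n hB hA

lemma subsingleton_retract_left {X X' Y : C} (i : X' ⟶ X) (r : X ⟶ X') (hir : i ≫ r = 𝟙 X')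
    {n : ℕ} (hn : 1 ≤ n) (hX : Subsingleton (H.ext n X Y)) : Subsingleton (H.ext n X' Y) := by
  cases H with
  | abelian hab hc =>
    rw [subsingleton_abelian_iff hab hc] at hX ⊢
    let := hab.toAbelian
    let : HasExt.{max u v} C := HasExt.standard C
    exact subsingleton_ext_retract_left i r hir hX
  | triangulated φ h₁ h₂ h₃ =>
    rw [subsingleton_triangulated_iff] at hX ⊢
    refine subsingleton_of_forall_eq 0 fun f => ?_
    rw [← Category.id_comp f, ← hir, Category.assoc, Subsingleton.elim (r ≫ f) 0, comp_zero]
  | enough hproj hinj =>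
    obtain ⟨n, rfl⟩ := Nat.exists_eq_add_of_le' hn
    rw [subsingleton_enough_iff] at hX ⊢
    exact subsingleton_EE_retract_left i r hir hX

end HigherExtensions

end Extri

namespace Extri

open scoped ZeroObject

/-! ### Closure properties, resolutions and relative projective dimension -/

section Classes

variable {C : Type u} [Category.{v} C] [Preadditive C] [HasBinaryBiproducts C]

section

variable {𝒳 𝒴 : ObjectProperty C}

lemma ClosedUnderSummands.right (h : ClosedUnderSummands 𝒳) {M A B : C} (e : M ≅ A ⊞ B)
    (hM : 𝒳 M) : 𝒳 B :=
  h M B A ⟨e ≪≫ biprod.braiding A B⟩ hM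

lemma ClosedUnderSummands.inf (h : ClosedUnderSummands 𝒳) (h' : ClosedUnderSummands 𝒴) :
    ClosedUnderSummands (𝒳 ⊓ 𝒴) :=
  fun M A B e hM => ⟨h M A B e hM.1, h' M A B e hM.2⟩

variable [HasZeroObject C]

lemma ClosedUnderSummands.of_iso (h : ClosedUnderSummands 𝒳) {M M' : C} (e : M ≅ M')
    (hM : 𝒳 M) : 𝒳 M' :=
  h M M' 0 ⟨e ≪≫
    { hom := biprod.inl
      inv := biprod.fst
      inv_hom_id := by ext; simp }⟩ hM

lemma ClosedUnderSummands.zero (h : ClosedUnderSummands 𝒳) {M : C} (hM : 𝒳 M) : 𝒳 0 :=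
  h M 0 M ⟨
    { hom := biprod.inr
      inv := biprod.snd
      inv_hom_id := by ext; simp }⟩ hM

end

variable [HasZeroObject C] [ExtriangulatedCategory.{w} C] {𝒳 𝒴 ω S : ObjectProperty C}

lemma ClosedUnderExtensions.inf (h : ClosedUnderExtensions 𝒳) (h' : ClosedUnderExtensions 𝒴) :
    ClosedUnderExtensions (𝒳 ⊓ 𝒴) :=
  fun A B Z c hA hZ => ⟨h A B Z c hA.1 hZ.1, h' A B Z c hA.2 hZ.2⟩

lemma LeftThick.inf (h : LeftThick 𝒳) (h' : LeftThick 𝒴) : LeftThick (𝒳 ⊓ 𝒴) where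
  extensions := h.extensions.inf h'.extensions
  summands := h.summands.inf h'.summands
  cocones A B Z c hB hZ := ⟨h.cocones A B Z c hB.1 hZ.1, h'.cocones A B Z c hB.2 hZ.2⟩

lemma RightThick.inf (h : RightThick 𝒳) (h' : RightThick 𝒴) : RightThick (𝒳 ⊓ 𝒴) where
  extensions := h.extensions.inf h'.extensions
  summands := h.summands.inf h'.summands
  cones A B Z c hA hB := ⟨h.cones A B Z c hA.1 hB.1, h'.cones A B Z c hA.2 hB.2⟩

lemma ClosedUnderExtensions.biprod (h : ClosedUnderExtensions 𝒳) {M N : C} (hM : 𝒳 M)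
    (hN : 𝒳 N) : 𝒳 (M ⊞ N) :=
  h _ _ _ (hasConflation_biprod M N) hM hN

lemma le_wedge (𝒳 : ObjectProperty C) : 𝒳 ≤ wedge 𝒳 :=
  fun M hM => ⟨0, 0, le_rfl, M, hM, ⟨Iso.refl M⟩⟩

lemma wedge_of_hasConflation {K X M : C} (h : HasConflation K X M) (hX : 𝒳 X)
    (hK : wedge 𝒳 K) : wedge 𝒳 M := by
  obtain ⟨-, m, -, hm⟩ := hK
  exact ⟨m + 1, m + 1, le_rfl, K, X, hX, hm, h⟩

lemma wedge_le (h : RightThick 𝒴) (hle : 𝒳 ≤ 𝒴) : wedge 𝒳 ≤ 𝒴 := by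
  rintro M ⟨-, m, -, hm⟩
  induction m generalizing M with
  | zero =>
    obtain ⟨X, hX, ⟨e⟩⟩ := hm
    exact h.summands.of_iso e (hle X hX)
  | succ m ih =>
    obtain ⟨K, X, hX, hK, hc⟩ := hm
    exact h.cones _ _ _ hc (ih K hK) (hle X hX)

lemma Thick.le (h : IsThick 𝒴) (hle : 𝒳 ≤ 𝒴) : Thick 𝒳 ≤ 𝒴 :=
  fun _ hM => hM 𝒴 h hle

lemma ClosedUnderSummands.of_resLE_zero (h : ClosedUnderSummands 𝒳) {M : C}
    (hM : resLE 𝒳 0 M) : 𝒳 M := by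
  obtain ⟨m, hm, hr⟩ := hM
  obtain rfl := Nat.le_zero.1 hm
  obtain ⟨X, hX, ⟨e⟩⟩ := hr
  exact h.of_iso e hX

lemma ClosedUnderSummands.of_coresLE_zero (h : ClosedUnderSummands 𝒳) {M : C}
    (hM : coresLE 𝒳 0 M) : 𝒳 M := by
  obtain ⟨m, hm, hr⟩ := hM
  obtain rfl := Nat.le_zero.1 hm
  obtain ⟨X, hX, ⟨e⟩⟩ := hr
  exact h.of_iso e hX

lemma resLE_zero_of_mem {M : C} (hM : 𝒳 M) : resLE 𝒳 0 M :=
  ⟨0, le_rfl, M, hM, ⟨Iso.refl M⟩⟩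

lemma coresLE_zero_of_mem {M : C} (hM : 𝒳 M) : coresLE 𝒳 0 M :=
  ⟨0, le_rfl, M, hM, ⟨Iso.refl M⟩⟩

variable {H : HigherExtensions.{w} C}

lemma ClosedUnderSummands.right_of_split (h : ClosedUnderSummands 𝒳) {A B Z : C}
    (hc : HasConflation A B Z) (hv : Subsingleton (H.ext 1 Z A)) (hB : 𝒳 B) : 𝒳 Z := by
  have := H.subsingleton_EE hv
  exact h.right hc.nonempty_iso_biprod.some hB

lemma ClosedUnderSummands.left_of_split (h : ClosedUnderSummands 𝒳) {A B Z : C}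
    (hc : HasConflation A B Z) (hv : Subsingleton (H.ext 1 Z A)) (hB : 𝒳 B) : 𝒳 A := by
  have := H.subsingleton_EE hv
  exact h _ _ _ hc.nonempty_iso_biprod hB

/-- `pd_𝒴(M) ≤ n`. -/
def ProjDimLE (H : HigherExtensions.{w} C) (𝒴 : ObjectProperty C) (n : ℕ) (M : C) : Prop :=
  ∀ j, n < j → ∀ Y, 𝒴 Y → Subsingleton (H.ext j M Y)

namespace ProjDimLE

variable {A B Z M N : C} {n m : ℕ}

lemma mono (h : ProjDimLE H 𝒴 n M) (hnm : n ≤ m) : ProjDimLE H 𝒴 m M :=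
  fun j hj => h j (hnm.trans_lt hj)

lemma extension (hc : HasConflation A B Z) (hA : ProjDimLE H 𝒴 n A) (hZ : ProjDimLE H 𝒴 n Z) :
    ProjDimLE H 𝒴 n B :=
  fun j hj Y hY => H.subsingleton_mid_left hc (by lia) (hA j hj Y hY) (hZ j hj Y hY)

lemma cocone (hc : HasConflation A B Z) (hB : ProjDimLE H 𝒴 n B)
    (hZ : ProjDimLE H 𝒴 (n + 1) Z) : ProjDimLE H 𝒴 n A :=
  fun j hj Y hY => H.subsingleton_cocone_left hc (by lia) (hB j hj Y hY)
    (hZ (j + 1) (by lia) Y hY)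

lemma cone (hc : HasConflation A B Z) (hA : ProjDimLE H 𝒴 n A)
    (hB : ProjDimLE H 𝒴 (n + 1) B) : ProjDimLE H 𝒴 (n + 1) Z := by
  intro j hj Y hY
  obtain ⟨j, rfl⟩ := Nat.exists_eq_add_of_le' (show 1 ≤ j by lia)
  exact H.subsingleton_cone_left hc (by lia) (hA j (by lia) Y hY) (hB (j + 1) hj Y hY)

lemma retract (h : ProjDimLE H 𝒴 n M) (i : N ⟶ M) (r : M ⟶ N) (hir : i ≫ r = 𝟙 N) :
    ProjDimLE H 𝒴 n N :=
  fun j hj Y hY => H.subsingleton_retract_left i r hir (by lia) (h j hj Y hY)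

lemma of_injDim (hi : injDim H 𝒳 𝒴 = 0) (hM : 𝒳 M) : ProjDimLE H 𝒴 n M :=
  fun j hj Y hY => (injDim_eq_zero_iff H 𝒳 𝒴).1 hi j (by lia) M Y hM hY

end ProjDimLE

/-- Finiteness, without a fixed bound, is what makes this class closed under cones, where the
dimension may rise by one. It bounds the induction for every object of a thick closure. -/
lemma isThick_projDimLE (H : HigherExtensions.{w} C) (𝒴 : ObjectProperty C) :
    IsThick fun M : C => ∃ n, ProjDimLE H 𝒴 n M := by
  have hext : ClosedUnderExtensions fun M : C => ∃ n, ProjDimLE H 𝒴 n M := by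
    rintro A B Z hc ⟨n, hA⟩ ⟨m, hZ⟩
    exact ⟨n + m, .extension hc (hA.mono (by lia)) (hZ.mono (by lia))⟩
  have hsum : ClosedUnderSummands fun M : C => ∃ n, ProjDimLE H 𝒴 n M := by
    rintro M A B ⟨e⟩ ⟨n, hM⟩
    exact ⟨n, hM.retract (biprod.inl ≫ e.inv) (e.hom ≫ biprod.fst) (by simp)⟩
  refine ⟨⟨hext, hsum, ?_⟩, ⟨hext, hsum, ?_⟩⟩
  · rintro A B Z hc ⟨n, hB⟩ ⟨m, hZ⟩
    exact ⟨n + m, .cocone hc (hB.mono (by lia)) (hZ.mono (by lia))⟩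
  · rintro A B Z hc ⟨n, hA⟩ ⟨m, hB⟩
    exact ⟨n + m + 1, .cone hc (hA.mono (by lia)) (hB.mono (by lia))⟩

lemma exists_projDimLE_of_thick (hi : injDim H 𝒳 𝒴 = 0) {M : C} (hM : Thick 𝒳 M) :
    ∃ n, ProjDimLE H 𝒴 n M :=
  Thick.le (isThick_projDimLE H 𝒴) (fun _ hX => ⟨0, .of_injDim hi hX⟩) M hM

end Classes

/-! ### From cotorsion pairs cut on the thick closure to AB-contexts -/

section CotorsionPairs

variable {C : Type u} [Category.{v} C] [Preadditive C] [HasZeroObject C] [HasBinaryBiproducts C]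
  [ExtriangulatedCategory.{w} C] {H : HigherExtensions.{w} C} {S ℱ 𝒢 : ObjectProperty C}

namespace CotorsionPairCut

lemma exists_left_approx (h : CotorsionPairCut H 1 (Thick ℱ) ℱ 𝒢) {M : C} (hM : Thick ℱ M) :
    ∃ K A, 𝒢 K ∧ ℱ A ∧ HasConflation K A M := by
  obtain ⟨K, A, hA, hK, hc⟩ := h.left.complete M hM
  exact ⟨K, A, h.right.summands.of_resLE_zero hK, hA, hc⟩

lemma exists_right_approx (h : CotorsionPairCut H 1 (Thick ℱ) ℱ 𝒢) {M : C} (hM : Thick ℱ M) :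
    ∃ B L, 𝒢 B ∧ ℱ L ∧ HasConflation M B L := by
  obtain ⟨B, L, hB, hL, hc⟩ := h.right.complete M hM
  exact ⟨B, L, hB, h.left.summands.of_coresLE_zero hL, hc⟩

/-- The kernel of the special approximation lies in `𝒢`, so the hypothesis splits it and `M` becomes
a summand of an object of `ℱ`. -/
lemma mem_left (h : CotorsionPairCut H 1 (Thick ℱ) ℱ 𝒢) {M : C} (hM : Thick ℱ M)
    (hv : ∀ K, 𝒢 K → Subsingleton (H.ext 1 M K)) : ℱ M := by
  obtain ⟨K, A, hK, hA, hc⟩ := h.exists_left_approx hM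
  exact h.left.summands.right_of_split hc (hv K hK) hA

lemma mem_right (h : CotorsionPairCut H 1 (Thick ℱ) ℱ 𝒢) {M : C} (hM : Thick ℱ M)
    (hv : ∀ A, ℱ A → Subsingleton (H.ext 1 A M)) : 𝒢 M := by
  obtain ⟨B, L, hB, hL, hc⟩ := h.exists_right_approx hM
  exact h.right.summands.left_of_split hc (hv L hL) hB

lemma leftThick (h : CotorsionPairCut H 1 (Thick ℱ) ℱ 𝒢) (hi : injDim H ℱ 𝒢 = 0) :
    LeftThick ℱ where
  extensions A B Z hc hA hZ := h.mem_left
    ((isThick_thick ℱ).left.extensions A B Z hc (le_thick ℱ A hA) (le_thick ℱ Z hZ))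
    (ProjDimLE.extension hc (ProjDimLE.of_injDim (n := 0) hi hA) (.of_injDim hi hZ) 1 one_pos)
  summands := h.left.summands
  cocones A B Z hc hB hZ := h.mem_left
    ((isThick_thick ℱ).left.cocones A B Z hc (le_thick ℱ B hB) (le_thick ℱ Z hZ))
    (ProjDimLE.cocone hc (ProjDimLE.of_injDim (n := 0) hi hB) (.of_injDim hi hZ) 1 one_pos)

lemma rightThick (h : CotorsionPairCut H 1 (Thick ℱ) ℱ 𝒢) (hi : injDim H ℱ 𝒢 = 0) :
    RightThick (𝒢 ⊓ Thick ℱ) where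
  extensions A B Z hc hA hZ := by
    have hB := (isThick_thick ℱ).left.extensions A B Z hc hA.2 hZ.2
    rw [injDim_eq_zero_iff] at hi
    exact ⟨h.mem_right hB fun X hX => H.subsingleton_mid_right hc le_rfl
      (hi 1 le_rfl X A hX hA.1) (hi 1 le_rfl X Z hX hZ.1), hB⟩
  summands := h.right.summands.inf (isThick_thick ℱ).left.summands
  cones A B Z hc hA hB := by
    have hZ := (isThick_thick ℱ).right.cones A B Z hc hA.2 hB.2
    rw [injDim_eq_zero_iff] at hi
    exact ⟨h.mem_right hZ fun X hX => H.subsingleton_cone_right hc le_rfl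
      (hi 1 le_rfl X B hX hB.1) (hi 2 one_le_two X A hX hA.1), hZ⟩

/-- The special left approximation of an object of `𝒢` lies in the core. -/
lemma exists_core_approx (h : CotorsionPairCut H 1 (Thick ℱ) ℱ 𝒢) (hi : injDim H ℱ 𝒢 = 0)
    {M : C} (hM : (𝒢 ⊓ Thick ℱ) M) :
    ∃ K W, (𝒢 ⊓ Thick ℱ) K ∧ (ℱ ⊓ 𝒢) W ∧ HasConflation K W M := by
  obtain ⟨K, A, hK, hA, hc⟩ := h.exists_left_approx hM.2
  have hK' : (𝒢 ⊓ Thick ℱ) K :=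
    ⟨hK, (isThick_thick ℱ).left.cocones _ _ _ hc (le_thick ℱ A hA) hM.2⟩
  exact ⟨K, A, hK', ⟨hA, ((h.rightThick hi).extensions _ _ _ hc hK' hM).1⟩, hc⟩

/-- One inclusion is right thickness of `𝒢 ⊓ Thick ℱ`. For the other, each core approximation lowers
the projective dimension relative to `𝒢` by one; in dimension zero the object already lies in `ℱ`,
hence in the core. -/
lemma wedge_core (h : CotorsionPairCut H 1 (Thick ℱ) ℱ 𝒢) (hi : injDim H ℱ 𝒢 = 0) :
    wedge (ℱ ⊓ 𝒢) = 𝒢 ⊓ Thick ℱ := by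
  apply le_antisymm
  · exact wedge_le (h.rightThick hi) fun M hM => ⟨hM.2, le_thick ℱ M hM.1⟩
  · intro M hM
    obtain ⟨n, hn⟩ := exists_projDimLE_of_thick hi hM.2
    induction n generalizing M with
    | zero => exact le_wedge _ M ⟨h.mem_left hM.2 (hn 1 one_pos), hM.1⟩
    | succ n ih =>
      obtain ⟨K, W, hK, hW, hc⟩ := h.exists_core_approx hi hM
      exact wedge_of_hasConflation hc hW (ih K hK (.cocone hc (.of_injDim hi hW.1) hn))

lemma inf_wedge_core (h : CotorsionPairCut H 1 (Thick ℱ) ℱ 𝒢) (hi : injDim H ℱ 𝒢 = 0) :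
    ℱ ⊓ wedge (ℱ ⊓ 𝒢) = ℱ ⊓ 𝒢 := by
  rw [h.wedge_core hi]
  exact le_antisymm (fun M hM => ⟨hM.1, hM.2.1⟩) fun M hM => ⟨hM.1, hM.2, le_thick ℱ M hM.1⟩

end CotorsionPairCut

namespace MemP

lemma inf_wedge (h : MemP H S ℱ 𝒢) : ℱ ⊓ wedge (ℱ ⊓ 𝒢) = ℱ ⊓ 𝒢 :=
  h.cotorsion.inf_wedge_core h.injDim_eq

/-- The core approximation `W ⟶ M` need not come from `S`, so it is precomposed with `U ⟶ W` for `U`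
in the core and in `S`. The new kernel `K'` is an extension of `K` by a core object, hence stays in
`𝒢 ⊓ Thick ℱ`. It also lies in `S`, as the cocone of `U ⟶ M`, so the induction continues. -/
lemma wedge_inf_le (h : MemP H S ℱ 𝒢) (hS : IsThick S) :
    wedge (ℱ ⊓ 𝒢) ⊓ S ≤ wedge (ℱ ⊓ S) := by
  rw [h.cotorsion.wedge_core h.injDim_eq]
  rintro M ⟨hM, hMS⟩
  have hi := h.injDim_eq
  have hr := h.cotorsion.rightThick hi
  obtain ⟨n, hn⟩ := exists_projDimLE_of_thick hi hM.2
  induction n generalizing M with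
  | zero => exact le_wedge _ M ⟨h.cotorsion.mem_left hM.2 (hn 1 one_pos), hMS⟩
  | succ n ih =>
    obtain ⟨K, W, hK, hW, hc⟩ := h.cotorsion.exists_core_approx hi hM
    obtain ⟨V, U, hU, hV, hc'⟩ := h.generator.2 W hW
    obtain ⟨K', hK', hK''⟩ := hc'.comp_deflation hc
    exact wedge_of_hasConflation hK' ⟨hU.1.1, hU.2⟩ (ih K'
      (hr.extensions _ _ _ hK'' ⟨hV.2, le_thick ℱ V hV.1⟩ hK)
      (hS.left.cocones _ _ _ hK' hU.2 hMS) (.cocone hK' (.of_injDim hi hU.1.1) hn))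

/-- The right approximation `B` of `X` is an extension of two objects of `ℱ`, so it lies in the core
and embeds in some `W` from `S`. The cokernel of the composite inflation is in `ℱ` by extensions and
in `S` by cones. -/
lemma relCogenerator (h : MemP H S ℱ 𝒢) (hS : IsThick S) :
    RelCogenerator (ℱ ⊓ 𝒢 ⊓ S) (ℱ ⊓ S) := by
  refine ⟨fun M hM => ⟨hM.1.1, hM.2⟩, fun X hX => ?_⟩
  have hl := h.cotorsion.leftThick h.injDim_eq
  obtain ⟨B, L, hB, hL, hc⟩ := h.cotorsion.exists_right_approx (le_thick ℱ X hX.1)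
  obtain ⟨W, B', hW, hB', hc'⟩ := h.cogenerator.2 B ⟨hl.extensions _ _ _ hc hX.1 hL, hB⟩
  obtain ⟨K, hK, hK'⟩ := hc.comp_inflation hc'
  exact ⟨W, K, hW, ⟨hl.extensions _ _ _ hK' hL hB'.1, hS.right.cones _ _ _ hK hX.2 hW.2⟩, hK⟩

lemma cutLeftWeakABContext (h : MemP H S ℱ 𝒢) (hS : IsThick S) :
    CutLeftWeakABContext H S ℱ (wedge (ℱ ⊓ 𝒢)) := by
  have hi := h.injDim_eq
  have hl := h.cotorsion.leftThick hi
  have hr := h.cotorsion.rightThick hi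
  have hsum : ClosedUnderSummands (ℱ ⊓ 𝒢) :=
    h.cotorsion.left.summands.inf h.cotorsion.right.summands
  have hv := (injDim_eq_zero_iff H ℱ 𝒢).1 hi
  refine ⟨?_, ?_, h.wedge_inf_le hS⟩
  · rw [h.inf_wedge]
    refine ⟨hl, ⟨hl.inf hS.left, hsum.inf hS.left.summands, ?_, h.relCogenerator hS⟩, ?_,
      h.generator, ?_, hsum⟩
    · rw [injDim_eq_zero_iff]
      exact fun j hj X Y hX hY => hv j hj X Y hX.1 hY.1.2
    · rw [projDim_eq_zero_iff]
      exact fun j hj X Y hX hY => hv j hj X Y hX.1.1 hY.2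
    · intro A B Z hc hA hZ
      exact ⟨hl.extensions _ _ _ hc hA.1 hZ.1, (hr.extensions _ _ _ hc
        ⟨hA.2, le_thick ℱ A hA.1⟩ ⟨hZ.2, le_thick ℱ Z hZ.1⟩).1⟩
  · rw [h.cotorsion.wedge_core hi]
    exact hr.inf hS.right

end MemP

end CotorsionPairs

/-! ### Auslander-Buchweitz approximations and the thick class they define -/

section ABContexts

variable {C : Type u} [Category.{v} C] [Preadditive C] [HasZeroObject C] [HasBinaryBiproducts C]
  [ExtriangulatedCategory.{w} C] {H : HigherExtensions.{w} C} {𝒳 𝒴 ω : ObjectProperty C}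

variable (𝒳 𝒴) in
/-- The objects with a special `𝒳`-precover whose kernel lies in `𝒴`. -/
def specialLeft : ObjectProperty C :=
  fun M => ∃ K A, 𝒴 K ∧ 𝒳 A ∧ HasConflation K A M

/-- The inflation of `A` into its cogenerator object is composed with `K ⟶ A`; the cokernel of the
composite is the special preenvelope of `M`. -/
lemma specialLeft.exists_right (hω : RelCogenerator ω 𝒳) (hle : ω ≤ 𝒴) (hY : ClosedUnderCones 𝒴)
    {M : C} (hM : specialLeft 𝒳 𝒴 M) : ∃ B L, 𝒴 B ∧ 𝒳 L ∧ HasConflation M B L := by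
  obtain ⟨K, A, hK, hA, hc⟩ := hM
  obtain ⟨W, A', hW, hA', hc'⟩ := hω.2 A hA
  obtain ⟨Q, hQ, hQ'⟩ := hc.comp_inflation hc'
  exact ⟨Q, A', hY _ _ _ hQ hK (hle W hW), hA', hQ'⟩

/-- Induction on the resolution length: the syzygy has a special preenvelope by the previous step,
and pushing out the resolution along it replaces the kernel by an object of `𝒴` at the cost of an
extension inside `𝒳`. -/
lemma specialLeft_of_wedge (hX : LeftThick 𝒳) (hω : RelCogenerator ω 𝒳)
    (hωs : ClosedUnderSummands ω) (hle : ω ≤ 𝒴) (hY : ClosedUnderCones 𝒴) :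
    wedge 𝒳 ≤ specialLeft 𝒳 𝒴 := by
  rintro M ⟨-, m, -, hm⟩
  induction m generalizing M with
  | zero =>
    obtain ⟨X, hM, ⟨e⟩⟩ := hm
    obtain ⟨W, -, hW, -⟩ := hω.2 X hM
    exact ⟨0, M, hle _ (hωs.zero hW), hX.summands.of_iso e hM, hasConflation_zero_left M⟩
  | succ m ih =>
    obtain ⟨K, X, hX', hK, hc⟩ := hm
    obtain ⟨Q, A', hQ, hA', hc'⟩ := (ih K hK).exists_right hω hle hY
    obtain ⟨P, hP, hP'⟩ := hc.pushout hc'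
    exact ⟨Q, P, hQ, hX.extensions _ _ _ hP hX' hA', hP'⟩

/-- The objects `Y` with `𝔼^i(𝒳, Y) = 0` for all `i ≥ 1`. -/
def rightPerp (H : HigherExtensions.{w} C) (𝒳 : ObjectProperty C) : ObjectProperty C :=
  fun Y => ∀ j, 1 ≤ j → ∀ X, 𝒳 X → Subsingleton (H.ext j X Y)

lemma closedUnderCones_rightPerp : ClosedUnderCones (rightPerp H 𝒳) :=
  fun _ _ _ hc hA hB j hj X hX => H.subsingleton_cone_right hc hj (hB j hj X hX)
    (hA (j + 1) (by lia) X hX)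

variable (hX : LeftThick 𝒳) (hY : RightThick 𝒴) (hω : RelCogenerator (𝒳 ⊓ 𝒴) 𝒳)
  (hle : 𝒴 ≤ wedge 𝒳)

include hX hY hω hle

lemma injDim_eq_zero_of_core (hi : injDim H 𝒳 (𝒳 ⊓ 𝒴) = 0) : injDim H 𝒳 𝒴 = 0 := by
  rw [injDim_eq_zero_iff] at hi ⊢
  have hcore : 𝒳 ⊓ 𝒴 ≤ 𝒴 ⊓ rightPerp H 𝒳 :=
    fun M hM => ⟨hM.2, fun j hj X hX => hi j hj X M hX hM⟩
  intro j hj X Y hXm hYm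
  -- The approximation is taken with kernel in `𝒴 ⊓ rightPerp H 𝒳`, not merely in `𝒴`. Then `A` lies
  -- in the core, hence in the perpendicular class, and so does the cone `Y`.
  obtain ⟨K, A, hK, hA, hc⟩ := specialLeft_of_wedge hX hω (hX.summands.inf hY.summands) hcore
    (fun A B Z hc hA hB => ⟨hY.cones A B Z hc hA.1 hB.1,
      closedUnderCones_rightPerp A B Z hc hA.2 hB.2⟩) Y (hle Y hYm)
  exact closedUnderCones_rightPerp _ _ _ hc hK.2
    (hcore A ⟨hA, hY.extensions _ _ _ hc hK.1 hYm⟩).2 j hj X hXm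

lemma isThick_specialLeft (hi : injDim H 𝒳 𝒴 = 0) : IsThick (specialLeft 𝒳 𝒴) := by
  have hXD : 𝒳 ≤ specialLeft 𝒳 𝒴 := (le_wedge 𝒳).trans
    (specialLeft_of_wedge hX hω (hX.summands.inf hY.summands) inf_le_right hY.cones)
  have hYD : 𝒴 ≤ specialLeft 𝒳 𝒴 := hle.trans
    (specialLeft_of_wedge hX hω (hX.summands.inf hY.summands) inf_le_right hY.cones)
  have hext : ClosedUnderExtensions (specialLeft 𝒳 𝒴) := by
    rintro A B Z hc hA ⟨K, X, hK, hXm, hc'⟩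
    obtain ⟨Y, L, hYm, hL, hA'⟩ := hA.exists_right hω inf_le_right hY.cones
    -- Pulling back to `X` and pushing out to `Y` yields a conflation `Y ⟶ P ⟶ X`, which splits. A
    -- precover of `Y ⊞ X` is then easy, and it is transported back through the fibre of `P ⟶ L` and
    -- along `B' ⟶ B`.
    obtain ⟨B', hB', hB''⟩ := hc.pullback hc'
    obtain ⟨P, hP, hP'⟩ := hB'.pushout hA'
    have := H.subsingleton_EE ((injDim_eq_zero_iff H 𝒳 𝒴).1 hi 1 le_rfl X Y hXm hYm)
    obtain ⟨e⟩ := hP'.nonempty_iso_biprod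
    obtain ⟨K', X', hK', hX', hY'⟩ := hYD Y hYm
    obtain ⟨N, hN, hN'⟩ :=
      ((hY'.biprod (hasConflation_zero_left X)).of_iso_right e).comp_deflation hP
    obtain ⟨Q, hQ, hQ'⟩ := hN'.comp_deflation hB''
    exact ⟨Q, N, hY.extensions _ _ _ hQ'
        (hY.extensions.biprod hK' (hY.summands.zero hK)) hK,
      hX.cocones _ _ _ hN (hX.extensions.biprod hX' hXm) hL, hQ⟩
  have hcone : ClosedUnderCones (specialLeft 𝒳 𝒴) := by
    rintro A B Z hc hA hB
    obtain ⟨Y, L, hYm, hL, hA'⟩ := hA.exists_right hω inf_le_right hY.cones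
    obtain ⟨P, hP, hP'⟩ := hc.pushout hA'
    obtain ⟨K, X, hK, hXm, hc'⟩ := hext _ _ _ hP hB (hXD L hL)
    obtain ⟨Q, hQ, hQ'⟩ := hc'.comp_deflation hP'
    exact ⟨Q, X, hY.extensions _ _ _ hQ' hK hYm, hXm, hQ⟩
  have hcocone : ClosedUnderCocones (specialLeft 𝒳 𝒴) := by
    rintro A B Z hc hB ⟨K, X, hK, hXm, hc'⟩
    obtain ⟨P, hP, hP'⟩ := hc.pullback hc'
    obtain ⟨K', X', hK', hX', hc''⟩ := hext _ _ _ hP' (hYD K hK) hB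
    obtain ⟨N, hN, hN'⟩ := hc''.comp_deflation hP
    exact ⟨K', N, hK', hX.cocones _ _ _ hN hX' hXm, hN'⟩
  have hsum : ClosedUnderSummands (specialLeft 𝒳 𝒴) := by
    rintro N M M' ⟨e⟩ hN
    obtain ⟨n, hn⟩ : ∃ n, ProjDimLE H 𝒴 n N := by
      obtain ⟨K, A, hK, hA, hc⟩ := hN
      exact exists_projDimLE_of_thick hi ((isThick_thick 𝒳).right.cones _ _ _ hc
        (wedge_le (isThick_thick 𝒳).right (le_thick 𝒳) K (hle K hK)) (le_thick 𝒳 A hA))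
    induction n generalizing N M M' with
    | zero =>
      obtain ⟨K, A, hK, hA, hc⟩ := hN
      exact hXD M (hX.summands _ _ _ ⟨e⟩
        (hX.summands.right_of_split hc (hn 1 one_pos K hK) hA))
    | succ n ih =>
      have hN' := hN
      obtain ⟨K, A, hK, hA, hc⟩ := hN'
      -- The kernel `K` of `A ⟶ N` need not decompose along `M ⊞ M'`. The kernels of `A ⟶ M` and `A
      -- ⟶ M'` are used instead: `Ω ⊞ Ω'` is a syzygy of `N` over `A ⊞ A`, of smaller dimension and
      -- with `Ω` as a summand. Induction handles `Ω`, and closure under cones then gives `M`.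
      obtain ⟨Ω, hΩ, -⟩ := hc.comp_deflation
        (hasConflation_of_iso_biprod (e ≪≫ biprod.braiding M M'))
      obtain ⟨Ω', hΩ', -⟩ := hc.comp_deflation (hasConflation_of_iso_biprod e)
      have hA2 : 𝒳 (A ⊞ A) := hX.extensions.biprod hA hA
      have hs : specialLeft 𝒳 𝒴 (Ω ⊞ Ω') := hcocone _ _ _ (hΩ.biprod hΩ') (hXD _ hA2)
        ⟨K, A, hK, hA, hc.of_iso_right e.symm⟩
      exact hcone _ _ _ hΩ (ih _ _ _ (Iso.refl _) hs (.cocone (hΩ.biprod hΩ') (.of_injDim hi hA2)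
        (hn.retract e.inv e.hom e.inv_hom_id))) (hXD A hA)
  exact ⟨⟨hext, hsum, hcocone⟩, ⟨hext, hsum, hcone⟩⟩

lemma cotorsionPairCut_of_core (hi : injDim H 𝒳 𝒴 = 0) :
    CotorsionPairCut H 1 (Thick 𝒳) 𝒳 𝒴 := by
  have hv := (injDim_eq_zero_iff H 𝒳 𝒴).1 hi
  have hT : Thick 𝒳 ≤ specialLeft 𝒳 𝒴 := Thick.le (isThick_specialLeft hX hY hω hle hi)
    ((le_wedge 𝒳).trans
      (specialLeft_of_wedge hX hω (hX.summands.inf hY.summands) inf_le_right hY.cones))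
  refine ⟨⟨hX.summands, fun i h1 _ X Y hX hY => hv i h1 X Y hX.1 hY, fun M hM => ?_⟩,
    ⟨hY.summands, fun i h1 _ X Y hX hY => hv i h1 X Y hX hY.1, fun M hM => ?_⟩⟩
  · obtain ⟨K, A, hK, hA, hc⟩ := hT M hM
    exact ⟨K, A, hA, resLE_zero_of_mem hK, hc⟩
  · obtain ⟨B, L, hB, hL, hc⟩ := (hT M hM).exists_right hω inf_le_right hY.cones
    exact ⟨B, L, hB, coresLE_zero_of_mem hL, hc⟩

end ABContexts

/-! ### The two assignments and the bijection -/

section Correspondence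

variable {C : Type u} [Category.{v} C] [Preadditive C] [HasZeroObject C] [HasBinaryBiproducts C]
  [ExtriangulatedCategory.{w} C] {H : HigherExtensions.{w} C} {S 𝒜 ℬ : ObjectProperty C}

lemma relGenerator_self (h : ClosedUnderSummands 𝒜) : RelGenerator 𝒜 𝒜 :=
  ⟨le_rfl, fun X hX => ⟨0, X, hX, h.zero hX, hasConflation_zero_left X⟩⟩

lemma relCogenerator_self (h : ClosedUnderSummands 𝒜) : RelCogenerator 𝒜 𝒜 :=
  ⟨le_rfl, fun X hX => ⟨X, 0, hX, h.zero hX, hasConflation_zero_right X⟩⟩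

lemma CutLeftWeakABContext.memP (h : CutLeftWeakABContext H S 𝒜 ℬ) :
    MemP H S (𝒜 ⊓ S) (ℬ ⊓ S) := by
  have hf := h.frobenius.frobenius
  have hcore : 𝒜 ⊓ ℬ ⊓ S = (𝒜 ⊓ S) ⊓ (ℬ ⊓ S) := inf_inf_distrib_right 𝒜 ℬ S
  have hω := hf.cogenerator
  have hi := hf.injective
  rw [hcore] at hω hi
  have hi' := injDim_eq_zero_of_core hf.leftThick h.rightThick hω h.le_wedge hi
  have hsum := hf.leftThick.summands.inf h.rightThick.summands
  -- After restriction the core already lies in `S`, so it generates and cogenerates itself through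
  -- trivial conflations.
  have hS : (𝒜 ⊓ S) ⊓ (ℬ ⊓ S) ⊓ S = (𝒜 ⊓ S) ⊓ (ℬ ⊓ S) := inf_eq_left.2 fun M hM => hM.1.2
  refine ⟨cotorsionPairCut_of_core hf.leftThick h.rightThick hω h.le_wedge hi', hi', ?_, ?_⟩
  · rw [hS]
    exact relGenerator_self hsum
  · rw [hS]
    exact relCogenerator_self hsum

end Correspondence

end Extri

theorem theorem5p5 {C : Type u} [Category.{v} C] [Preadditive C] [HasZeroObject C]
    [HasBinaryBiproducts C] [Extri.ExtriangulatedCategory.{w} C] (H : Extri.HigherExtensions.{w} C)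
    (S : ObjectProperty C) (hS : Extri.IsThick S) :
    ∃ Λ : Quotient (Extri.pSetoid H S) ≃ Quotient (Extri.cSetoid H S),
      (∀ (ℱ 𝒢 : ObjectProperty C) (h : Extri.MemP H S ℱ 𝒢),
        ∃ h' : Extri.CutLeftWeakABContext H S ℱ (Extri.wedge (ℱ ⊓ 𝒢)),
          Λ (Quotient.mk (Extri.pSetoid H S) ⟨(ℱ, 𝒢), h⟩) =
            Quotient.mk (Extri.cSetoid H S) ⟨(ℱ, Extri.wedge (ℱ ⊓ 𝒢)), h'⟩) ∧
      (∀ (𝒜 ℬ : ObjectProperty C) (h : Extri.CutLeftWeakABContext H S 𝒜 ℬ),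
        ∃ h' : Extri.MemP H S (𝒜 ⊓ S) (ℬ ⊓ S),
          Λ.symm (Quotient.mk (Extri.cSetoid H S) ⟨(𝒜, ℬ), h⟩) =
            Quotient.mk (Extri.pSetoid H S) ⟨(𝒜 ⊓ S, ℬ ⊓ S), h'⟩) := by
  have hSS (𝒜 : ObjectProperty C) : 𝒜 ⊓ S ⊓ S = 𝒜 ⊓ S := inf_eq_left.2 inf_le_right
  have hcore (𝒜 ℬ : ObjectProperty C) : (𝒜 ⊓ S) ⊓ (ℬ ⊓ S) ⊓ S = 𝒜 ⊓ ℬ ⊓ S := by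
    rw [← inf_inf_distrib_right, hSS]
  refine ⟨
    { toFun := Quotient.map (fun q => ⟨(q.1.1, Extri.wedge (q.1.1 ⊓ q.1.2)),
        q.2.cutLeftWeakABContext hS⟩) ?_
      invFun := Quotient.map (fun q => ⟨(q.1.1 ⊓ S, q.1.2 ⊓ S), q.2.memP⟩) ?_
      left_inv := ?_
      right_inv := ?_ },
    fun ℱ 𝒢 h => ⟨h.cutLeftWeakABContext hS, rfl⟩, fun 𝒜 ℬ h => ⟨h.memP, rfl⟩⟩
  · rintro ⟨⟨ℱ, 𝒢⟩, h⟩ ⟨⟨ℱ', 𝒢'⟩, h'⟩ ⟨h₁, h₂⟩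
    refine ⟨h₁, ?_⟩
    dsimp only at h₂ h h' ⊢
    -- The image pairs have the same cores as the original pairs, so the hypothesis on cores carries
    -- over unchanged.
    rwa [h.inf_wedge, h'.inf_wedge]
  · rintro ⟨⟨𝒜, ℬ⟩, h⟩ ⟨⟨𝒜', ℬ'⟩, h'⟩ ⟨h₁, h₂⟩
    refine ⟨?_, ?_⟩
    · dsimp only at h₁ ⊢
      rwa [hSS, hSS]
    · dsimp only at h₂ ⊢
      rwa [hcore, hcore]
  · rintro ⟨⟨ℱ, 𝒢⟩, h⟩
    refine Quotient.sound ⟨hSS ℱ, ?_⟩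
    dsimp only at h ⊢
    rw [hcore, h.inf_wedge]
  · rintro ⟨⟨𝒜, ℬ⟩, h⟩
    refine Quotient.sound ⟨hSS 𝒜, ?_⟩
    dsimp only at h ⊢
    rw [h.memP.inf_wedge, hcore]
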